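/- Let $m,n\ge 1$ be integers and let $\mathbb{R}^{n+1}_+=\{(x,t): x\in\mathbb{R}^n,\ t>0\}$. For $\lambda>-1$ put $dm_\lambda(x,t)=t^\lambda\,dx\,dt$ on $\mathbb{R}^{n+1}_+$. For $0<p<\infty$ let $A^p_\lambda$ be the space of all complex-valued harmonic functions $f$ on $\mathbb{R}^{n+1}_+$ with $\|f\|_{A^p_\lambda}=\big(\int_{\mathbb{R}^{n+1}_+}|f|^p\,dm_\lambda\big)^{1/p}<\infty$. For $\vec s=(s_1,\dots,s_m)$ with all $s_j>-1$, let $A^p_{\vec s}$ be the space of all complex-valued functions $f(z_1,\dots,z_m)$ that are harmonic on $(\mathbb{R}^{n+1}_+)^m\subset\mathbb{R}^{(n+1)m}$ and satisfy $\|f\|_{A^p_{\vec s}}=\big(\int|f|^p\,dm_{s_1}(z_1)\cdots dm_{s_m}(z_m)\big)^{1/p}<\infty$, and let $\tilde hA^p_{\vec s}$ be the subspace of those $f\in A^p_{\vec s}$ that are harmonic in each variable $z_j\in\mathbb{R}^{n+1}_+$ separately. The trace operator is $(\mathrm{Tr} f)(z)=f(z,\dots,z)$, $z\in\mathbb{R}^{n+1}_+$.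 Let $\{\Delta_k\}_{k\ge1}$ be a Whitney decomposition of $\mathbb{R}^{n+1}_+$: closed cubes with sides parallel to the coordinate axes and pairwise disjoint interiors, with $\bigcup_k\Delta_k=\mathbb{R}^{n+1}_+$ and $c\,\mathrm{dist}(\Delta_k,\partial\mathbb{R}^{n+1}_+)\le\mathrm{diam}\,\Delta_k\le C\,\mathrm{dist}(\Delta_k,\partial\mathbb{R}^{n+1}_+)$ for all $k$ with constants $c,C>0$ independent of $k$. Write $|\Delta_k|$ for the Lebesgue measure of $\Delta_k$. **Theorem 2.** Let $0<p<\infty$, $s_1,\dots,s_m>-1$, and let $\mu$ be a positive Borel measure on $\mathbb{R}^{n+1}_+$. Then the following conditions are equivalent: (i) there is a constant $C<\infty$ such that $\displaystyle\frac{\mu(\Delta_k)}{|\Delta_k|^{\,m+\frac1{n+1}\sum_{j=1}^m s_j}}\le C$ for all $k\ge1$; (ii) the trace operator is bounded from $A^p_{\vec s}$ to $L^p(\mathbb{R}^{n+1}_+,d\mu)$, i.e. there is a constant $C<\infty$ such that $\mathrm{Tr} f\in L^p(\mu)$ and $\|\mathrm{Tr} f\|_{L^p(\mu)}\le C\|f\|_{A^p_{\vec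 s}}$ for all $f\in A^p_{\vec s}$; (iii) the trace operator is bounded, in the same sense, from $\tilde hA^p_{\vec s}$ to $L^p(\mathbb{R}^{n+1}_+,d\mu)$; (iv) there is a constant $C<\infty$ such that for all $f_j\in A^p_{s_j}$, $1\le j\le m$, $$\int_{\mathbb{R}^{n+1}_+}\prod_{j=1}^m|f_j(z)|^p\,d\mu(z)\le C\prod_{j=1}^m\|f_j\|^p_{A^p_{s_j}}.$$ -/

import Mathlib

open MeasureTheory

noncomputable section

/-- The space `ℝ^{n+1}`; a point is `z = (x, t)` with `t = z (Fin.last n)` the last coordinate. -/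
abbrev AmbientSpace (n : ℕ) : Type := EuclideanSpace ℝ (Fin (n + 1))

/-- The upper half space `ℝ₊^{n+1} = {(x, t) : t > 0}`. -/
def upperHalfSpace (n : ℕ) : Set (AmbientSpace n) :=
  {z | 0 < z (Fin.last n)}

/-- The distance between two sets, `inf {|z - w| : z ∈ A, w ∈ B}` (for nonempty `A`, `B`). -/
def setDistance {n : ℕ} (A B : Set (AmbientSpace n)) : ℝ :=
  sInf (Set.image2 dist A B)

/-- A closed nondegenerate cube with sides parallel to the coordinate axes. -/
def IsClosedCube {n : ℕ} (A : Set (AmbientSpace n)) : Prop :=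
  ∃ (a : AmbientSpace n) (l : ℝ), 0 < l ∧ A = {z | ∀ i, a i ≤ z i ∧ z i ≤ a i + l}

/-- `Q 0, Q 1, …` is a Whitney decomposition of the upper half space: closed cubes with sides
parallel to the axes and pairwise disjoint interiors, whose union is the upper half space, and
whose diameters are comparable, uniformly in `k`, to their distances to the boundary. -/
structure IsWhitneyDecomposition {n : ℕ} (Q : ℕ → Set (AmbientSpace n)) : Prop where
  cube : ∀ k, IsClosedCube (Q k)
  iUnion_eq : ⋃ k, Q k = upperHalfSpace n
  disjoint_interior : ∀ k l, k ≠ l → Disjoint (interior (Q k)) (interior (Q l))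
  diam_comparable : ∃ c C : ℝ, 0 < c ∧ 0 < C ∧ ∀ k,
    c * setDistance (Q k) (frontier (upperHalfSpace n)) ≤ Metric.diam (Q k) ∧
    Metric.diam (Q k) ≤ C * setDistance (Q k) (frontier (upperHalfSpace n))

/-- The measure `dm_r = t^r dx dt`, carried by the upper half space. -/
def weightedMeasure (n : ℕ) (r : ℝ) : Measure (AmbientSpace n) :=
  (volume.restrict (upperHalfSpace n)).withDensity
    (fun z => ENNReal.ofReal (z (Fin.last n) ^ r))

/-- The product measure `dm_{s_1}(z_1) ⋯ dm_{s_m}(z_m)`, carried by `(ℝ₊^{n+1})^m`. -/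
def productWeightedMeasure (n : ℕ) {m : ℕ} (s : Fin m → ℝ) :
    Measure (Fin m → AmbientSpace n) :=
  Measure.pi (fun j => weightedMeasure n (s j))

/-- The weighted harmonic Bergman space `A_r^p` on the upper half space (complex valued functions;
only their values on the upper half space matter). -/
def bergmanSpace (n : ℕ) (p r : ℝ) : Set (AmbientSpace n → ℂ) :=
  {f | InnerProductSpace.HarmonicOnNhd f (upperHalfSpace n) ∧
    MemLp f (ENNReal.ofReal p) (weightedMeasure n r)}

/-- `f` is harmonic on `(ℝ₊^{n+1})^m` as an open subset of the Euclidean space `ℝ^{(n+1)m}`.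
The space `PiLp 2` is the `m`-fold product with its Euclidean norm. -/
def IsJointlyHarmonic {n m : ℕ} (f : (Fin m → AmbientSpace n) → ℂ) : Prop :=
  InnerProductSpace.HarmonicOnNhd
    (fun z : PiLp 2 (fun _ : Fin m => AmbientSpace n) => f (WithLp.ofLp z))
    {z | ∀ j, z j ∈ upperHalfSpace n}

/-- `f` is harmonic on the upper half space in each of the variables `z_1, …, z_m` separately, the
other variables being fixed in the upper half space. -/
def IsSeparatelyHarmonic {n m : ℕ} (f : (Fin m → AmbientSpace n) → ℂ) : Prop :=
  ∀ z : Fin m → AmbientSpace n, (∀ j, z j ∈ upperHalfSpace n) → ∀ j,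
    InnerProductSpace.HarmonicOnNhd (fun w => f (Function.update z j w)) (upperHalfSpace n)

/-- The space `A_s^p`, `s = (s_1, …, s_m)`, of functions that are harmonic on `(ℝ₊^{n+1})^m` and
lie in `L^p(dm_{s_1} ⋯ dm_{s_m})`. -/
def productBergmanSpace (n : ℕ) {m : ℕ} (p : ℝ) (s : Fin m → ℝ) :
    Set ((Fin m → AmbientSpace n) → ℂ) :=
  {f | IsJointlyHarmonic f ∧ MemLp f (ENNReal.ofReal p) (productWeightedMeasure n s)}

/-- The subspace of those elements of `A_s^p` that are harmonic in each variable. -/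
def separateBergmanSpace (n : ℕ) {m : ℕ} (p : ℝ) (s : Fin m → ℝ) :
    Set ((Fin m → AmbientSpace n) → ℂ) :=
  productBergmanSpace n p s ∩ {f | IsSeparatelyHarmonic f}

/-- The trace on the diagonal, `(Tr f)(z) = f(z, …, z)`. -/
def diagonalTrace {n m : ℕ} (f : (Fin m → AmbientSpace n) → ℂ) : AmbientSpace n → ℂ :=
  fun z => f (fun _ => z)

/-- The trace operator is bounded from a space `X` of functions on `(ℝ₊^{n+1})^m`, with the
(quasi-)norm of `L^p(dm_{s_1} ⋯ dm_{s_m})`, to `L^p(ℝ₊^{n+1}, dμ)`. -/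
def TraceBounded {n m : ℕ} (p : ℝ) (s : Fin m → ℝ) (μ : Measure (AmbientSpace n))
    (X : Set ((Fin m → AmbientSpace n) → ℂ)) : Prop :=
  ∃ C : NNReal, ∀ f ∈ X,
    MemLp (diagonalTrace f) (ENNReal.ofReal p) (μ.restrict (upperHalfSpace n)) ∧
    eLpNorm (diagonalTrace f) (ENNReal.ofReal p) (μ.restrict (upperHalfSpace n)) ≤
      C * eLpNorm f (ENNReal.ofReal p) (productWeightedMeasure n s)

end

/-! Write `t` for the height of a point and `E = (n + 1) m + ∑ s_j` (`carlesonExponent`). The four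
conditions are proved equivalent in a cycle.

Carleson condition ⇒ bounded trace. For harmonic `f` and every `p > 0`, `‖f‖ ^ p` satisfies a
sub-mean value inequality up to a constant (`exists_enorm_rpow_le_setLIntegral_of_harmonic`). Apply
it in dimension `(n + 1) m` at the diagonal point `(w, …, w)`, on a ball of radius `t / 4`. Each
coordinate stays in `ball w (t / 2)`, where all heights are comparable to `t`, so the weights are
essentially constant and `‖Tr f (w)‖ ^ p` is at most `C t ^ (-E)` times the weighted integral over
the product of these balls (`exists_enorm_trace_rpow_le`). On a Whitney cube the factor `t ^ (-E)`
cancels `μ (Q k) ≲ l ^ E`, and the local integrals add up because the expanded cubes have bounded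
overlap.

Restriction to separately harmonic functions is an inclusion of spaces. The product inequality is
the trace inequality for `∏ f_j (z_j)`, which is harmonic jointly and separately and whose norm
factorizes.

Product inequality ⇒ Carleson condition. Each cube needs functions in `A_{s_j}^p` of modulus at
least one on it, with `p`-th power of the norm `≲ t ^ (n + 1 + s_j)`; the exponents add up to `E`.
They must decay fast when `p` is small and yet have no zeros on the cube. The Kelvin transform of a
power of the null linear form `u_{n+1} + i u_1`, with pole below the boundary, does both: its real
part `u_{n+1}` is positive there (`exists_bergman_testFunction`). -/

noncomputable section

open InnerProductSpace Metric Set Filter Topology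
open scoped Laplacian

/-! ### The mean value property, by averaging against a radial kernel. -/

section MeanValue

/-- The square of the positive part is differentiable. -/
theorem hasDerivAt_sq_max_zero (s : ℝ) :
    HasDerivAt (fun s : ℝ => max 0 s ^ 2) (2 * max 0 s) s := by
  rcases lt_trichotomy s 0 with h | h | h
  · have : (fun s : ℝ => max 0 s ^ 2) =ᶠ[𝓝 s] fun _ => 0 := by
      filter_upwards [gt_mem_nhds h] with x hx
      simp [max_eq_left hx.le]
    rw [max_eq_left h.le, mul_zero]
    exact (hasDerivAt_const s (0 : ℝ)).congr_of_eventuallyEq this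
  · subst h
    simp only [max_self, mul_zero]
    rw [hasDerivAt_iff_isLittleO]
    have h2 : (fun x : ℝ => x ^ 2) =o[𝓝 0] fun x => x := by
      simpa using Asymptotics.isLittleO_pow_pow (𝕜 := ℝ) (m := 1) (n := 2) (by norm_num)
    have h1 : (fun x : ℝ => max 0 x ^ 2) =O[𝓝 0] fun x => x ^ 2 := by
      refine Asymptotics.IsBigO.of_bound 1 (Eventually.of_forall fun x => ?_)
      rcases le_total 0 x with hx | hx
      · simp [max_eq_right hx]
      · simp [max_eq_left hx, sq_nonneg]
    simpa using h1.trans_isLittleO h2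
  · have : (fun s : ℝ => max 0 s ^ 2) =ᶠ[𝓝 s] fun x => x ^ 2 := by
      filter_upwards [lt_mem_nhds h] with x hx
      simp [max_eq_right hx.le]
    rw [max_eq_right h.le]
    have := (hasDerivAt_pow 2 s).congr_of_eventuallyEq this
    simpa using this

variable {E : Type*} [NormedAddCommGroup E]

/-- A radial averaging kernel supported in the closed unit ball. -/
def radialBump (y : E) : ℝ := max 0 (1 - ‖y‖ ^ 2)

theorem continuous_radialBump : Continuous (radialBump : E → ℝ) := by
  unfold radialBump; fun_prop

theorem radialBump_nonneg (y : E) : 0 ≤ radialBump y := le_max_left _ _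

theorem radialBump_le_one (y : E) : radialBump y ≤ 1 := by
  simp [radialBump]

theorem radialBump_eq_zero {y : E} (hy : y ∉ ball (0 : E) 1) : radialBump y = 0 := by
  have : 1 ≤ ‖y‖ := by simpa using hy
  exact max_eq_left (by nlinarith)

variable [InnerProductSpace ℝ E]

/-- The point of this kernel: the gradient of its square is radial and is again a multiple of the
kernel. Integrating the square against a Laplacian therefore produces the kernel against a radial
derivative. -/
theorem hasFDerivAt_sq_radialBump (y : E) :
    HasFDerivAt (fun y : E => radialBump y ^ 2) ((-4 * radialBump y) • innerSL ℝ y) y := by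
  have h1 : HasFDerivAt (fun y : E => 1 - ‖y‖ ^ 2) (-(2 • innerSL ℝ y)) y :=
    (hasStrictFDerivAt_norm_sq y).hasFDerivAt.const_sub 1
  have h := (hasDerivAt_sq_max_zero (1 - ‖y‖ ^ 2)).comp_hasFDerivAt y h1
  refine h.congr_fderiv ?_
  ext v
  simp [radialBump]
  ring

variable [FiniteDimensional ℝ E]

theorem hasCompactSupport_radialBump : HasCompactSupport (radialBump : E → ℝ) :=
  HasCompactSupport.intro (isCompact_closedBall 0 1) fun _ hy =>
    radialBump_eq_zero fun h => hy (ball_subset_closedBall h)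

/-- A function which is harmonic near a closed ball agrees there with a global `C²` function. -/
theorem InnerProductSpace.HarmonicOnNhd.exists_contDiff_eqOn {f : E → ℂ} {x : E} {R : ℝ}
    (hR : 0 < R) (hf : HarmonicOnNhd f (closedBall x R)) :
    ∃ g : E → ℂ, ContDiff ℝ 2 g ∧ EqOn g f (closedBall x R) := by
  obtain ⟨δ, hδ, hsub⟩ := (isCompact_closedBall x R).exists_cthickening_subset_open
    (isOpen_setOfPred_harmonicAt f) hf
  rw [cthickening_closedBall hδ.le hR.le] at hsub
  -- The cutoff is one on the given ball and vanishes outside the ball of radius `δ + R`, on which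
  -- `f` is still harmonic.
  let χ : ContDiffBump x := ⟨R, δ + R, hR, by linarith⟩
  refine ⟨fun y => χ y • f y, ?_, fun y hy => ?_⟩
  · rw [contDiff_iff_contDiffAt]
    intro y
    by_cases hy : y ∈ closedBall x (δ + R)
    · exact χ.contDiff.contDiffAt.smul (hsub hy).1
    · have : (fun y => χ y • f y) =ᶠ[𝓝 y] fun _ => 0 := by
        filter_upwards [isClosed_closedBall.isOpen_compl.mem_nhds hy] with z hz
        have hz' : χ.rOut ≤ dist z x := by
          have : δ + R < dist z x := by simpa using hz
          exact this.le
        simp [χ.zero_of_le_dist hz']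
      exact contDiffAt_const.congr_of_eventuallyEq this
  · simp [χ.one_of_mem_closedBall hy]

variable [MeasurableSpace E] [BorelSpace E] (ν : Measure E) [ν.IsAddHaarMeasure]

theorem integral_radialBump_pos : 0 < ∫ y, radialBump y ∂ν := by
  refine (continuous_radialBump.integral_pos_of_hasCompactSupport_nonneg_nonzero
    hasCompactSupport_radialBump (fun y => radialBump_nonneg y) (x := 0) ?_)
  simp [radialBump]

/-- Green's formula for the radial kernel: the flux of a function which is harmonic in the ball
vanishes. -/
theorem integral_radialBump_fderiv_eq_zero {f : E → ℂ} (hf : ContDiff ℝ 2 f) {x : E} {R : ℝ}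
    (hΔ : ∀ y ∈ ball x R, (Δ f) y = 0) {ρ : ℝ} (hρ : 0 ≤ ρ) (hρR : ρ ≤ R) :
    ∫ y, radialBump y • fderiv ℝ f (x + ρ • y) y ∂ν = 0 := by
  set b := stdOrthonormalBasis ℝ E
  have hf1 : ContDiff ℝ 1 (fderiv ℝ f) := hf.fderiv_right (by norm_num)
  have hcs : HasCompactSupport (fun y : E => ((radialBump y : ℝ) : ℂ)) :=
    hasCompactSupport_radialBump.comp_left (g := fun t : ℝ => (t : ℂ)) (by simp)
  have hcs2 : HasCompactSupport (fun y : E => ((radialBump y ^ 2 : ℝ) : ℂ)) :=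
    hasCompactSupport_radialBump.comp_left (g := fun t : ℝ => ((t ^ 2 : ℝ) : ℂ)) (by simp)
  have hcont := continuous_radialBump (E := E)
  have hDu : ∀ v y : E, HasFDerivAt (fun y => fderiv ℝ f (x + ρ • y) v)
      ((ContinuousLinearMap.apply ℝ ℂ v).comp
        ((fderiv ℝ (fderiv ℝ f) (x + ρ • y)).comp (ρ • ContinuousLinearMap.id ℝ E))) y := by
    intro v y
    have h1 : HasFDerivAt (fun y : E => x + ρ • y) (ρ • ContinuousLinearMap.id ℝ E) y :=
      ((hasFDerivAt_id y).const_smul ρ).const_add x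
    have h2 := ((hf1.differentiable one_ne_zero) (x + ρ • y)).hasFDerivAt.comp y h1
    exact (ContinuousLinearMap.apply ℝ ℂ v).hasFDerivAt.comp y h2
  have hcD : Continuous (fun y : E => fderiv ℝ f (x + ρ • y)) :=
    (hf.continuous_fderiv (by norm_num)).comp (by fun_prop)
  have hcDD : Continuous (fun y : E => fderiv ℝ (fderiv ℝ f) (x + ρ • y)) :=
    (hf1.continuous_fderiv (by norm_num)).comp (by fun_prop)
  -- Integration by parts in the direction `b i`: the sign it brings cancels the one in the gradient
  -- `-4 * radialBump y • y`.
  have key : ∀ i, ∫ y, ((radialBump y ^ 2 : ℝ) : ℂ) *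
        ((ρ : ℂ) * fderiv ℝ (fderiv ℝ f) (x + ρ • y) (b i) (b i)) ∂ν =
      4 * ∫ y, (radialBump y : ℂ) * ((inner ℝ (b i) y : ℝ) * fderiv ℝ f (x + ρ • y) (b i)) ∂ν := by
    intro i
    have hB : ∀ y, HasFDerivAt (fun y : E => ((radialBump y ^ 2 : ℝ) : ℂ))
        (Complex.ofRealCLM.comp ((-4 * radialBump y) • innerSL ℝ y)) y := fun y =>
      Complex.ofRealCLM.hasFDerivAt.comp y (hasFDerivAt_sq_radialBump y)
    have e1 : ∀ y, fderiv ℝ (fun y : E => ((radialBump y ^ 2 : ℝ) : ℂ)) y (b i) =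
        -4 * ((radialBump y : ℂ) * (inner ℝ (b i) y : ℝ)) := by
      intro y
      rw [(hB y).fderiv]
      simp [real_inner_comm]
      ring
    have e2 : ∀ y, fderiv ℝ (fun y => fderiv ℝ f (x + ρ • y) (b i)) y (b i) =
        (ρ : ℂ) * fderiv ℝ (fderiv ℝ f) (x + ρ • y) (b i) (b i) := by
      intro y
      rw [(hDu (b i) y).fderiv]
      simp
    have := integral_mul_fderiv_eq_neg_fderiv_mul_of_integrable (μ := ν) (v := b i)
      (f := fun y : E => ((radialBump y ^ 2 : ℝ) : ℂ))
      (g := fun y => fderiv ℝ f (x + ρ • y) (b i)) ?_ ?_ ?_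
      (fun y _ => (hB y).differentiableAt) (fun y _ => (hDu (b i) y).differentiableAt)
    · simp only [e1, e2] at this
      rw [this, ← integral_neg, ← integral_const_mul]
      congr 1
      ext y
      ring
    · simp only [e1]
      refine Continuous.integrable_of_hasCompactSupport ?_ ?_
      · fun_prop
      · exact (hcs.mul_right.mul_left).mul_right
    · simp only [e2]
      refine Continuous.integrable_of_hasCompactSupport ?_ ?_
      · fun_prop
      · exact hcs2.mul_right
    · refine Continuous.integrable_of_hasCompactSupport ?_ ?_
      · fun_prop
      · exact hcs2.mul_right
  have hsum : ∀ y : E, radialBump y • fderiv ℝ f (x + ρ • y) y = ∑ i, (radialBump y : ℂ) *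
      ((inner ℝ (b i) y : ℝ) * fderiv ℝ f (x + ρ • y) (b i)) := by
    intro y
    rw [← Finset.mul_sum]
    have h : fderiv ℝ f (x + ρ • y) y =
        ∑ i, ((inner ℝ (b i) y : ℝ) : ℂ) * fderiv ℝ f (x + ρ • y) (b i) := by
      conv_lhs => rw [← b.sum_repr' y]
      rw [← b.sum_repr' y, map_sum]
      simp [b.sum_repr' y]
    rw [h, Complex.real_smul]
  -- The sum over `i` is a multiple of the Laplacian at `x + ρ • y`, a point of the open ball when
  -- `‖y‖ < 1` and `ρ > 0`. For `ρ = 0` the factor `ρ` vanishes; for `‖y‖ ≥ 1` the kernel does.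
  have hsum2 : ∀ y : E, ∑ i, ((radialBump y ^ 2 : ℝ) : ℂ) *
        ((ρ : ℂ) * fderiv ℝ (fderiv ℝ f) (x + ρ • y) (b i) (b i)) = 0 := by
    intro y
    rw [← Finset.mul_sum, ← Finset.mul_sum]
    by_cases hy : y ∈ ball (0 : E) 1
    · rcases hρ.eq_or_lt with rfl | hρ0
      · simp
      have : (Δ f) (x + ρ • y) = 0 := by
        apply hΔ
        have hy1 : ‖y‖ < 1 := by simpa using hy
        simp only [mem_ball, dist_self_add_left, norm_smul, Real.norm_eq_abs, abs_of_pos hρ0]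
        nlinarith
      rw [laplacian_eq_iteratedFDeriv_orthonormalBasis f b] at this
      simp only [iteratedFDeriv_two_apply] at this
      simp at this
      simp [this]
    · simp [radialBump_eq_zero hy]
  simp only [hsum]
  rw [integral_finsetSum]
  · have h4 : (4 : ℂ) * ∑ i, ∫ y, (radialBump y : ℂ) *
        ((inner ℝ (b i) y : ℝ) * fderiv ℝ f (x + ρ • y) (b i)) ∂ν = 0 := by
      rw [Finset.mul_sum]
      simp only [← key]
      rw [← integral_finsetSum]
      · simp only [hsum2, integral_zero]
      · intro i _
        refine Continuous.integrable_of_hasCompactSupport ?_ ?_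
        · fun_prop
        · exact hcs2.mul_right
    simpa using h4
  · intro i _
    refine Continuous.integrable_of_hasCompactSupport ?_ ?_
    · fun_prop
    · exact hcs.mul_right

/-- The weighted mean value property for functions which are harmonic in a ball. -/
theorem integral_radialBump_smul_eq {f : E → ℂ} (hf : ContDiff ℝ 2 f) {x : E} {R : ℝ} (hR : 0 ≤ R)
    (hΔ : ∀ y ∈ ball x R, (Δ f) y = 0) :
    ∫ y, radialBump y • f (x + R • y) ∂ν = (∫ y, radialBump y ∂ν) • f x := by
  -- The weighted average over the ball of radius `ρ` is differentiated under the integral; its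
  -- derivative is the flux just shown to vanish. It is then constant on `[0, R]`, and at `ρ = 0` it
  -- is a multiple of `f x`.
  have hder : ∀ ρ : ℝ, HasDerivAt (fun ρ => ∫ y, radialBump y • f (x + ρ • y) ∂ν)
      (∫ y, radialBump y • fderiv ℝ f (x + ρ • y) y ∂ν) ρ := by
    intro ρ₀
    have hcD := hf.continuous_fderiv (n := 2) (by norm_num)
    obtain ⟨M, hM⟩ := (isCompact_closedBall x (|ρ₀| + 1)).exists_bound_of_continuousOn
      hcD.continuousOn
    have hcont := continuous_radialBump (E := E)
    have hcf := hf.continuous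
    refine (hasDerivAt_integral_of_dominated_loc_of_deriv_le (𝕜 := ℝ) (μ := ν)
      (F := fun ρ y => radialBump y • f (x + ρ • y))
      (F' := fun ρ y => radialBump y • fderiv ℝ f (x + ρ • y) y)
      (bound := fun y => radialBump y * M)
      (ball_mem_nhds ρ₀ one_pos) (Eventually.of_forall fun ρ => ?_) ?_ ?_ ?_ ?_ ?_).2
    · exact Continuous.aestronglyMeasurable (by fun_prop)
    · exact Continuous.integrable_of_hasCompactSupport (by fun_prop)
        hasCompactSupport_radialBump.smul_right
    · exact Continuous.aestronglyMeasurable (by fun_prop)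
    · refine Eventually.of_forall fun y ρ hρ => ?_
      rw [norm_smul, Real.norm_of_nonneg (radialBump_nonneg y)]
      by_cases hy : y ∈ ball (0 : E) 1
      · have hy1 : ‖y‖ < 1 := by simpa using hy
        refine mul_le_mul_of_nonneg_left ?_ (radialBump_nonneg y)
        have h1 : |ρ| ≤ |ρ₀| + 1 := by
          have : |ρ - ρ₀| < 1 := by simpa [Real.dist_eq] using hρ
          have := abs_sub_abs_le_abs_sub ρ ρ₀
          linarith
        have h2 := hM (x + ρ • y) (by
          simp only [mem_closedBall, dist_self_add_left, norm_smul, Real.norm_eq_abs]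
          nlinarith [abs_nonneg ρ, norm_nonneg y])
        calc _ ≤ ‖fderiv ℝ f (x + ρ • y)‖ * ‖y‖ := ContinuousLinearMap.le_opNorm _ _
          _ ≤ M * 1 := by gcongr; exact (norm_nonneg _).trans h2
          _ = M := mul_one M
      · simp [radialBump_eq_zero hy]
    · exact Continuous.integrable_of_hasCompactSupport (by fun_prop)
        hasCompactSupport_radialBump.mul_right
    · refine Eventually.of_forall fun y ρ _ => ?_
      have h1 : HasDerivAt (fun ρ : ℝ => x + ρ • y) y ρ := by
        simpa using ((hasDerivAt_id ρ).smul_const y).const_add x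
      have h2 := ((hf.differentiable (by norm_num)) (x + ρ • y)).hasFDerivAt.comp_hasDerivAt ρ h1
      exact h2.const_smul (radialBump y)
  have := constant_of_has_deriv_right_zero (a := 0) (b := R)
    (f := fun ρ => ∫ y, radialBump y • f (x + ρ • y) ∂ν)
    (fun ρ _ => (hder ρ).continuousAt.continuousWithinAt)
    (fun ρ hρ => by
      have := (hder ρ).hasDerivWithinAt (s := Ici ρ)
      rwa [integral_radialBump_fderiv_eq_zero ν hf hΔ hρ.1 hρ.2.le] at this)
    R ⟨hR, le_rfl⟩
  simp only [zero_smul, add_zero] at this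
  rw [this, integral_smul_const]

/-- The area mean value inequality for harmonic functions. -/
theorem exists_norm_le_setIntegral_norm_of_harmonic :
    ∃ C : ℝ, 0 < C ∧ ∀ (f : E → ℂ) (x : E) (R : ℝ), 0 < R → HarmonicOnNhd f (closedBall x R) →
      R ^ Module.finrank ℝ E * ‖f x‖ ≤ C * ∫ z in closedBall x R, ‖f z‖ ∂ν := by
  have hI := integral_radialBump_pos ν
  set I := ∫ y, radialBump y ∂ν
  refine ⟨I⁻¹, inv_pos.2 hI, fun f x R hR hf => ?_⟩
  obtain ⟨g, hg, hgf⟩ := hf.exists_contDiff_eqOn hR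
  have hΔ : ∀ y ∈ ball x R, (Δ g) y = 0 := by
    intro y hy
    have h1 : g =ᶠ[𝓝 y] f := by
      filter_upwards [isOpen_ball.mem_nhds hy] with z hz using hgf (ball_subset_closedBall hz)
    rw [(laplacian_congr_nhds h1).eq_of_nhds]
    exact (hf y (ball_subset_closedBall hy)).2.eq_of_nhds
  have hmv := integral_radialBump_smul_eq ν hg hR.le hΔ
  have hcg := hg.continuous
  have hcont := continuous_radialBump (E := E)
  have h1 : I * ‖f x‖ ≤ ∫ y in closedBall (0 : E) 1, ‖g (x + R • y)‖ ∂ν := by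
    have hx : g x = f x := hgf (mem_closedBall_self hR.le)
    calc I * ‖f x‖ = ‖∫ y, radialBump y • g (x + R • y) ∂ν‖ := by
          rw [hmv, norm_smul, Real.norm_of_nonneg hI.le, hx]
      _ = ‖∫ y in closedBall (0 : E) 1, radialBump y • g (x + R • y) ∂ν‖ := by
          rw [setIntegral_eq_integral_of_forall_compl_eq_zero]
          intro y hy
          rw [radialBump_eq_zero fun h => hy (ball_subset_closedBall h), zero_smul]
      _ ≤ ∫ y in closedBall (0 : E) 1, ‖radialBump y • g (x + R • y)‖ ∂ν :=
          norm_integral_le_integral_norm _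
      _ ≤ _ := by
          refine setIntegral_mono_on ?_ ?_ measurableSet_closedBall fun y _ => ?_
          · exact (Continuous.continuousOn (by fun_prop)).integrableOn_compact
              (isCompact_closedBall 0 1)
          · exact (Continuous.continuousOn (by fun_prop)).integrableOn_compact
              (isCompact_closedBall 0 1)
          · rw [norm_smul, Real.norm_of_nonneg (radialBump_nonneg y)]
            exact mul_le_of_le_one_left (norm_nonneg _) (radialBump_le_one y)
  have h2 : ∫ y in closedBall (0 : E) 1, ‖g (x + R • y)‖ ∂ν =
      (R ^ Module.finrank ℝ E)⁻¹ * ∫ z in closedBall x R, ‖f z‖ ∂ν := by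
    rw [Measure.setIntegral_comp_smul_of_pos ν (fun y => ‖g (x + y)‖) _ hR, smul_eq_mul,
      _root_.smul_closedBall _ _ zero_le_one, smul_zero, Real.norm_of_nonneg hR.le, mul_one]
    congr 1
    have h3 : (fun z => x + z) ⁻¹' closedBall x R = closedBall 0 R := by
      ext z; simp
    rw [← h3, (measurePreserving_add_left ν x).setIntegral_preimage_emb
      (MeasurableEquiv.addLeft x).measurableEmbedding (fun z => ‖g z‖)]
    exact setIntegral_congr_fun measurableSet_closedBall fun z hz => by simp only [hgf hz]
  rw [h2] at h1
  have hRN : 0 < R ^ Module.finrank ℝ E := by positivity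
  rw [inv_mul_eq_div, le_div_iff₀ hRN] at h1
  rw [inv_mul_eq_div, le_div_iff₀ hI]
  linarith

end MeanValue

/-! ### Sub-mean value inequalities for powers of harmonic functions. -/

section SubMeanValue

variable {E : Type*} [NormedAddCommGroup E] [InnerProductSpace ℝ E] [FiniteDimensional ℝ E]
  [MeasurableSpace E] [BorelSpace E] (ν : Measure E) [ν.IsAddHaarMeasure]

/-- A substitute for Jensen's inequality: for any level `a > 0`, `‖f‖ ≤ a + a ^ (1 - p) * ‖f‖ ^ p`.
With `a` a small multiple of `‖f x‖`, the first term is absorbed by the left side of the mean value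
inequality. -/
theorem exists_norm_rpow_le_setIntegral_of_one_le {p : ℝ} (hp : 1 ≤ p) :
    ∃ C : ℝ, 0 < C ∧ ∀ (f : E → ℂ) (x : E) (R : ℝ), 0 < R → HarmonicOnNhd f (closedBall x R) →
      R ^ Module.finrank ℝ E * ‖f x‖ ^ p ≤ C * ∫ z in closedBall x R, ‖f z‖ ^ p ∂ν := by
  obtain ⟨C, hC, hmv⟩ := exists_norm_le_setIntegral_norm_of_harmonic ν
  set V := ν.real (ball (0 : E) 1)
  have hV : 0 < V := ENNReal.toReal_pos (measure_ball_pos ν 0 one_pos).ne'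
    measure_ball_lt_top.ne
  -- Chosen so that the level `a = ε * ‖f x‖` contributes exactly half of `R ^ N * ‖f x‖`, where `N`
  -- is the dimension.
  set ε := (2 * C * V)⁻¹
  have hε : 0 < ε := by positivity
  refine ⟨2 * C * ε ^ (1 - p), by positivity, fun f x R hR hf => ?_⟩
  have hcf : ContinuousOn f (closedBall x R) := hf.continuousOn
  have hJ : 0 ≤ ∫ z in closedBall x R, ‖f z‖ ^ p ∂ν := integral_nonneg fun z => by positivity
  rcases eq_or_ne (f x) 0 with h0 | h0
  · rw [h0, norm_zero, Real.zero_rpow (by linarith), mul_zero]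
    positivity
  have hfx : 0 < ‖f x‖ := norm_pos_iff.2 h0
  set a := ε * ‖f x‖
  have ha : 0 < a := by positivity
  have hint : IntegrableOn (fun z => ‖f z‖ ^ p) (closedBall x R) ν :=
    (hcf.norm.rpow_const fun _ _ => Or.inr (by linarith)).integrableOn_compact
      (isCompact_closedBall x R)
  have hint1 : IntegrableOn (fun _ : E => a) (closedBall x R) ν :=
    continuousOn_const.integrableOn_compact (isCompact_closedBall x R)
  have h1 : ∫ z in closedBall x R, ‖f z‖ ∂ν ≤
      a * (R ^ Module.finrank ℝ E * V) + a ^ (1 - p) * ∫ z in closedBall x R, ‖f z‖ ^ p ∂ν := by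
    calc ∫ z in closedBall x R, ‖f z‖ ∂ν
        ≤ ∫ z in closedBall x R, (a + a ^ (1 - p) * ‖f z‖ ^ p) ∂ν := by
          refine setIntegral_mono_on ?_ (hint1.add (hint.const_mul _)) measurableSet_closedBall
            fun z _ => ?_
          · exact hcf.norm.integrableOn_compact (isCompact_closedBall x R)
          rcases le_or_gt ‖f z‖ a with h | h
          · have : 0 ≤ a ^ (1 - p) * ‖f z‖ ^ p := by positivity
            linarith
          · have hz : 0 < ‖f z‖ := ha.trans h
            have h2 : ‖f z‖ ^ (1 - p) ≤ a ^ (1 - p) :=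
              Real.rpow_le_rpow_of_nonpos ha h.le (by linarith)
            have h3 : ‖f z‖ = ‖f z‖ ^ (1 - p) * ‖f z‖ ^ p := by
              rw [← Real.rpow_add hz]; simp
            have h4 : ‖f z‖ ^ (1 - p) * ‖f z‖ ^ p ≤ a ^ (1 - p) * ‖f z‖ ^ p := by gcongr
            linarith
      _ = _ := by
          rw [integral_add hint1 (hint.const_mul _), integral_const_mul (a ^ (1 - p)),
            setIntegral_const, Measure.addHaar_real_closedBall _ _ hR.le, smul_eq_mul,
            mul_comm a]
  have h2 := hmv f x R hR hf
  have h3 : R ^ Module.finrank ℝ E * ‖f x‖ ≤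
      2 * C * ε ^ (1 - p) * ‖f x‖ ^ (1 - p) * ∫ z in closedBall x R, ‖f z‖ ^ p ∂ν := by
    have h4 : C * (a * (R ^ Module.finrank ℝ E * V)) = R ^ Module.finrank ℝ E * ‖f x‖ / 2 := by
      simp only [a, ε]; field_simp
    have h5 : a ^ (1 - p) = ε ^ (1 - p) * ‖f x‖ ^ (1 - p) := Real.mul_rpow hε.le hfx.le
    have h6 := h2.trans (mul_le_mul_of_nonneg_left h1 hC.le)
    rw [mul_add, h4, h5] at h6
    linarith
  have h7 : ‖f x‖ ^ p = ‖f x‖ * ‖f x‖ ^ (p - 1) := by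
    rw [Real.rpow_sub_one hfx.ne']; field_simp
  have h8 : ‖f x‖ ^ (1 - p) * ‖f x‖ ^ (p - 1) = 1 := by
    rw [← Real.rpow_add hfx]; simp
  calc R ^ Module.finrank ℝ E * ‖f x‖ ^ p
      = R ^ Module.finrank ℝ E * ‖f x‖ * ‖f x‖ ^ (p - 1) := by rw [h7, mul_assoc]
    _ ≤ 2 * C * ε ^ (1 - p) * ‖f x‖ ^ (1 - p) * (∫ z in closedBall x R, ‖f z‖ ^ p ∂ν) *
        ‖f x‖ ^ (p - 1) := by gcongr
    _ = 2 * C * ε ^ (1 - p) * (∫ z in closedBall x R, ‖f z‖ ^ p ∂ν) *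
        (‖f x‖ ^ (1 - p) * ‖f x‖ ^ (p - 1)) := by ring
    _ = _ := by rw [h8, mul_one]

/-- The Hardy–Littlewood argument, based on the maximum of `(R - dist y x) ^ (N / p) * ‖f y‖`. -/
theorem exists_norm_rpow_le_setIntegral_of_le_one {p : ℝ} (hp : 0 < p) (hp1 : p ≤ 1) :
    ∃ C : ℝ, 0 < C ∧ ∀ (f : E → ℂ) (x : E) (R : ℝ), 0 < R → HarmonicOnNhd f (closedBall x R) →
      R ^ Module.finrank ℝ E * ‖f x‖ ^ p ≤ C * ∫ z in closedBall x R, ‖f z‖ ^ p ∂ν := by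
  obtain ⟨C, hC, hmv⟩ := exists_norm_le_setIntegral_norm_of_harmonic ν
  set N := Module.finrank ℝ E
  set A : ℝ := 2 ^ (N / p)
  have hA : 0 < A := by positivity
  refine ⟨2 ^ N * C * A ^ (1 - p), by positivity, fun f x R hR hf => ?_⟩
  have hcf : ContinuousOn f (closedBall x R) := hf.continuousOn
  have hJ : 0 ≤ ∫ z in closedBall x R, ‖f z‖ ^ p ∂ν := integral_nonneg fun z => by positivity
  rcases eq_or_ne (f x) 0 with h0 | h0
  · rw [h0, norm_zero, Real.zero_rpow hp.ne', mul_zero]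
    positivity
  have hfx : 0 < ‖f x‖ := norm_pos_iff.2 h0
  have hint : IntegrableOn (fun z => ‖f z‖ ^ p) (closedBall x R) ν :=
    (hcf.norm.rpow_const fun _ _ => Or.inr hp.le).integrableOn_compact (isCompact_closedBall x R)
  obtain ⟨y, hy, hmax⟩ := (isCompact_closedBall x R).exists_isMaxOn
    (nonempty_closedBall.2 hR.le) (f := fun y => (R - dist y x) ^ N * ‖f y‖ ^ p)
    (by
      refine ContinuousOn.mul (by fun_prop) (hcf.norm.rpow_const fun _ _ => Or.inr hp.le))
  have hmax' : ∀ z ∈ closedBall x R,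
      (R - dist z x) ^ N * ‖f z‖ ^ p ≤ (R - dist y x) ^ N * ‖f y‖ ^ p := fun z hz => hmax hz
  have hx := hmax' x (mem_closedBall_self hR.le)
  rw [dist_self, sub_zero] at hx
  refine hx.trans ?_
  have hpos : 0 < (R - dist y x) ^ N * ‖f y‖ ^ p := lt_of_lt_of_le (by positivity) hx
  have hfy : 0 < ‖f y‖ := by
    by_contra h
    have : ‖f y‖ = 0 := le_antisymm (not_lt.1 h) (norm_nonneg _)
    rw [this, Real.zero_rpow hp.ne', mul_zero] at hpos
    exact hpos.false
  rcases (sub_nonneg.2 (mem_closedBall.1 hy)).eq_or_lt with hd | hd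
  · -- then the dimension is zero
    have hN : N = 0 := by
      by_contra hN
      rw [← hd, zero_pow hN, zero_mul] at hpos
      exact hpos.false
    have : Subsingleton E := Module.finrank_zero_iff.1 hN
    have hxy : y = x := Subsingleton.elim _ _
    rw [hxy, dist_self, sub_zero] at hd
    exact absurd hd hR.ne
  -- Half the distance from the maximum point to the sphere: on `closedBall y ρ` the distance to the
  -- sphere is at least `ρ`, so maximality gives `‖f‖ ^ p ≤ 2 ^ N * ‖f y‖ ^ p` there.
  set ρ := (R - dist y x) / 2
  have hρ : 0 < ρ := by positivity
  have h2ρ : R - dist y x = 2 * ρ := by simp only [ρ]; ring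
  rw [h2ρ] at hmax' ⊢
  have hsub : closedBall y ρ ⊆ closedBall x R := by
    refine closedBall_subset_closedBall' ?_
    linarith
  have hbd : ∀ z ∈ closedBall y ρ, ‖f z‖ ≤ A * ‖f y‖ := by
    intro z hz
    have h1 : ρ ≤ R - dist z x := by
      have := dist_triangle z y x
      have := mem_closedBall.1 hz
      linarith
    have h2 := hmax' z (hsub hz)
    have h3 : ρ ^ N * ‖f z‖ ^ p ≤ ρ ^ N * (2 ^ N * ‖f y‖ ^ p) := by
      calc ρ ^ N * ‖f z‖ ^ p ≤ (R - dist z x) ^ N * ‖f z‖ ^ p := by gcongr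
        _ ≤ _ := h2
        _ = _ := by rw [mul_pow]; ring
    have h4 := le_of_mul_le_mul_left h3 (by positivity)
    have h5 : (2 : ℝ) ^ N = A ^ p := by
      rw [← Real.rpow_mul zero_le_two, div_mul_cancel₀ _ hp.ne', Real.rpow_natCast]
    rw [h5, ← Real.mul_rpow hA.le hfy.le] at h4
    exact (Real.rpow_le_rpow_iff (norm_nonneg _) (by positivity) hp).1 h4
  have hmean := hmv f y ρ hρ (hf.mono hsub)
  -- Here `1 - p ≥ 0`, so `‖f‖ = ‖f‖ ^ (1 - p) * ‖f‖ ^ p` and the first factor is controlled by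
  -- `hbd`. The resulting power `‖f y‖ ^ (1 - p)` is later divided out.
  have h1 : ∫ z in closedBall y ρ, ‖f z‖ ∂ν ≤
      (A * ‖f y‖) ^ (1 - p) * ∫ z in closedBall x R, ‖f z‖ ^ p ∂ν := by
    calc ∫ z in closedBall y ρ, ‖f z‖ ∂ν
        ≤ ∫ z in closedBall y ρ, (A * ‖f y‖) ^ (1 - p) * ‖f z‖ ^ p ∂ν := by
          refine setIntegral_mono_on ?_ ((hint.mono_set hsub).const_mul _)
            measurableSet_closedBall fun z hz => ?_
          · exact (hcf.mono hsub).norm.integrableOn_compact (isCompact_closedBall y ρ)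
          rcases (norm_nonneg (f z)).eq_or_lt with h | h
          · rw [← h]; positivity
          · have h3 : ‖f z‖ = ‖f z‖ ^ (1 - p) * ‖f z‖ ^ p := by
              rw [← Real.rpow_add h]; simp
            calc ‖f z‖ = ‖f z‖ ^ (1 - p) * ‖f z‖ ^ p := h3
              _ ≤ _ := by
                gcongr
                exact hbd z hz
      _ = (A * ‖f y‖) ^ (1 - p) * ∫ z in closedBall y ρ, ‖f z‖ ^ p ∂ν := integral_const_mul _ _
      _ ≤ _ := by
          refine mul_le_mul_of_nonneg_left ?_ (by positivity)
          exact setIntegral_mono_set hint (Eventually.of_forall fun z => by positivity)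
            hsub.eventuallyLE
  have h2 := hmean.trans (mul_le_mul_of_nonneg_left h1 hC.le)
  rw [Real.mul_rpow hA.le hfy.le] at h2
  have h7 : ‖f y‖ ^ p = ‖f y‖ * ‖f y‖ ^ (p - 1) := by
    rw [Real.rpow_sub_one hfy.ne']; field_simp
  have h8 : ‖f y‖ ^ (1 - p) * ‖f y‖ ^ (p - 1) = 1 := by
    rw [← Real.rpow_add hfy]; simp
  calc (2 * ρ) ^ N * ‖f y‖ ^ p = 2 ^ N * (ρ ^ N * ‖f y‖) * ‖f y‖ ^ (p - 1) := by
        rw [h7, mul_pow]; simp only [mul_assoc]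
    _ ≤ 2 ^ N * (C * (A ^ (1 - p) * ‖f y‖ ^ (1 - p) * ∫ z in closedBall x R, ‖f z‖ ^ p ∂ν)) *
        ‖f y‖ ^ (p - 1) := by gcongr
    _ = 2 ^ N * C * A ^ (1 - p) * (∫ z in closedBall x R, ‖f z‖ ^ p ∂ν) *
        (‖f y‖ ^ (1 - p) * ‖f y‖ ^ (p - 1)) := by ring
    _ = _ := by rw [h8, mul_one]

/-- The sub-mean value property, up to a constant, of `‖f‖ ^ p` for `f` harmonic and `0 < p`. -/
theorem exists_enorm_rpow_le_setLIntegral_of_harmonic {p : ℝ} (hp : 0 < p) :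
    ∃ C : NNReal, ∀ (f : E → ℂ) (x : E) (R : ℝ), 0 < R → HarmonicOnNhd f (closedBall x R) →
      ENNReal.ofReal R ^ Module.finrank ℝ E * ‖f x‖ₑ ^ p ≤
        C * ∫⁻ z in closedBall x R, ‖f z‖ₑ ^ p ∂ν := by
  obtain ⟨C, hC, h⟩ : ∃ C : ℝ, 0 < C ∧ ∀ (f : E → ℂ) (x : E) (R : ℝ), 0 < R →
      HarmonicOnNhd f (closedBall x R) →
      R ^ Module.finrank ℝ E * ‖f x‖ ^ p ≤ C * ∫ z in closedBall x R, ‖f z‖ ^ p ∂ν := by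
    rcases le_total 1 p with h1 | h1
    · exact exists_norm_rpow_le_setIntegral_of_one_le ν h1
    · exact exists_norm_rpow_le_setIntegral_of_le_one ν hp h1
  refine ⟨C.toNNReal, fun f x R hR hf => ?_⟩
  have hcf : ContinuousOn f (closedBall x R) := hf.continuousOn
  have hint : IntegrableOn (fun z => ‖f z‖ ^ p) (closedBall x R) ν :=
    (hcf.norm.rpow_const fun _ _ => Or.inr hp.le).integrableOn_compact (isCompact_closedBall x R)
  have h1 := ENNReal.ofReal_le_ofReal (h f x R hR hf)
  rw [ENNReal.ofReal_mul (by positivity), ENNReal.ofReal_mul hC.le, ENNReal.ofReal_pow hR.le,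
    ofReal_integral_eq_lintegral_ofReal hint (Eventually.of_forall fun z => by positivity)] at h1
  simp only [← ENNReal.ofReal_rpow_of_nonneg (norm_nonneg _) hp.le, ofReal_norm] at h1
  exact h1

end SubMeanValue

/-! ### Geometry of Whitney cubes and bounded overlap. -/

section WhitneyGeometry

variable {n : ℕ}

/-- The closed cube with smallest corner `a` and side `l`. -/
def axisCube (a : AmbientSpace n) (l : ℝ) : Set (AmbientSpace n) :=
  {z | ∀ i, a i ≤ z i ∧ z i ≤ a i + l}

theorem isOpen_upperHalfSpace : IsOpen (upperHalfSpace n) :=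
  isOpen_lt continuous_const (by fun_prop)

theorem mem_upperHalfSpace {z : AmbientSpace n} : z ∈ upperHalfSpace n ↔ 0 < z (Fin.last n) :=
  Iff.rfl

theorem abs_apply_sub_le_dist (z w : AmbientSpace n) (i : Fin (n + 1)) : |z i - w i| ≤ dist z w := by
  rw [dist_eq_norm]
  exact PiLp.norm_apply_le (z - w) i

theorem mem_frontier_upperHalfSpace {z : AmbientSpace n} :
    z ∈ frontier (upperHalfSpace n) ↔ z (Fin.last n) = 0 := by
  constructor
  · intro hz
    exact (frontier_lt_subset_eq (f := fun _ : AmbientSpace n => (0 : ℝ))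
      (g := fun z => z (Fin.last n)) continuous_const (by fun_prop) hz).symm
  · intro hz
    rw [isOpen_upperHalfSpace.frontier_eq]
    refine ⟨?_, by simp [mem_upperHalfSpace, hz]⟩
    have h1 : Tendsto (fun τ : ℝ => z + τ • EuclideanSpace.single (Fin.last n) (1 : ℝ)) (𝓝[>] 0)
        (𝓝 z) := by
      have : Continuous fun τ : ℝ => z + τ • EuclideanSpace.single (Fin.last n) (1 : ℝ) := by
        fun_prop
      simpa using (this.tendsto 0).mono_left nhdsWithin_le_nhds
    refine mem_closure_of_tendsto h1 ?_
    filter_upwards [self_mem_nhdsWithin] with τ hτ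
    simpa [mem_upperHalfSpace, hz] using hτ

theorem corner_mem_axisCube (a : AmbientSpace n) {l : ℝ} (hl : 0 ≤ l) : a ∈ axisCube a l :=
  fun _ => ⟨le_rfl, by linarith⟩

theorem dist_le_of_mem_axisCube {a z w : AmbientSpace n} {l : ℝ} (hl : 0 ≤ l)
    (hz : z ∈ axisCube a l) (hw : w ∈ axisCube a l) : dist z w ≤ √(n + 1) * l := by
  rw [EuclideanSpace.dist_eq]
  refine Real.sqrt_le_iff.2 ⟨by positivity, ?_⟩
  calc ∑ i, dist (z i) (w i) ^ 2 ≤ ∑ _i : Fin (n + 1), l ^ 2 := by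
        refine Finset.sum_le_sum fun i _ => ?_
        have h1 := hz i
        have h2 := hw i
        have : dist (z i) (w i) ≤ l := by
          rw [Real.dist_eq, abs_le]; constructor <;> linarith
        gcongr
    _ = (√(n + 1) * l) ^ 2 := by
        rw [mul_pow, Real.sq_sqrt (by positivity)]; simp

theorem le_diam_axisCube (a : AmbientSpace n) {l : ℝ} (hl : 0 ≤ l) : l ≤ diam (axisCube a l) := by
  have hb : Bornology.IsBounded (axisCube a l) :=
    isBounded_iff.2 ⟨_, fun z hz w hw => dist_le_of_mem_axisCube hl hz hw⟩
  have h2 : a + EuclideanSpace.single 0 l ∈ axisCube a l := by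
    intro i
    by_cases hi : i = 0 <;> simp [hi, hl]
  have := dist_le_diam_of_mem hb (corner_mem_axisCube a hl) h2
  simpa [abs_of_nonneg hl] using this

theorem diam_axisCube_le (a : AmbientSpace n) {l : ℝ} (hl : 0 ≤ l) :
    diam (axisCube a l) ≤ √(n + 1) * l :=
  diam_le_of_forall_dist_le (by positivity) fun _ hz _ hw => dist_le_of_mem_axisCube hl hz hw

/-- The infimum is attained at the lowest corner and its vertical projection. This turns the Whitney
condition into a comparison of side and height. -/
theorem setDistance_axisCube_frontier {a : AmbientSpace n} {l : ℝ} (hl : 0 ≤ l)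
    (ha : 0 < a (Fin.last n)) :
    setDistance (axisCube a l) (frontier (upperHalfSpace n)) = a (Fin.last n) := by
  have hmem : a (Fin.last n) ∈ image2 dist (axisCube a l) (frontier (upperHalfSpace n)) := by
    refine ⟨a, corner_mem_axisCube a hl, a - EuclideanSpace.single (Fin.last n) (a (Fin.last n)),
      ?_, ?_⟩
    · rw [mem_frontier_upperHalfSpace]; simp
    · simp [abs_of_pos ha]
  have hlow : ∀ r ∈ image2 dist (axisCube a l) (frontier (upperHalfSpace n)),
      a (Fin.last n) ≤ r := by
    rintro _ ⟨z, hz, w, hw, rfl⟩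
    have h1 := abs_apply_sub_le_dist z w (Fin.last n)
    rw [mem_frontier_upperHalfSpace.1 hw, sub_zero] at h1
    exact (hz _).1.trans ((le_abs_self _).trans h1)
  exact le_antisymm (csInf_le ⟨_, hlow⟩ hmem) (le_csInf ⟨_, hmem⟩ hlow)

/-- The sides of Whitney cubes are uniformly comparable to their heights. -/
theorem IsWhitneyDecomposition.exists_axisCube {Q : ℕ → Set (AmbientSpace n)}
    (hQ : IsWhitneyDecomposition Q) :
    ∃ c C : ℝ, 0 < c ∧ 0 < C ∧ ∃ (a : ℕ → AmbientSpace n) (l : ℕ → ℝ), ∀ k,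
      Q k = axisCube (a k) (l k) ∧ 0 < l k ∧ 0 < a k (Fin.last n) ∧
      c * a k (Fin.last n) ≤ l k ∧ l k ≤ C * a k (Fin.last n) := by
  obtain ⟨c, C, hc, hC, h⟩ := hQ.diam_comparable
  choose a l hl hQk using hQ.cube
  have hQa : ∀ k, Q k = axisCube (a k) (l k) := hQk
  refine ⟨c / √(n + 1), C, by positivity, hC, a, l, fun k => ?_⟩
  have ha : 0 < a k (Fin.last n) := by
    rw [← mem_upperHalfSpace, ← hQ.iUnion_eq]
    exact mem_iUnion.2 ⟨k, by rw [hQa]; exact corner_mem_axisCube _ (hl k).le⟩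
  obtain ⟨h1, h2⟩ := h k
  rw [hQa, setDistance_axisCube_frontier (hl k).le ha] at h1 h2
  refine ⟨hQa k, hl k, ha, ?_, (le_diam_axisCube _ (hl k).le).trans h2⟩
  rw [div_mul_eq_mul_div, div_le_iff₀ (by positivity), mul_comm (l k)]
  exact h1.trans (diam_axisCube_le _ (hl k).le)

theorem volume_axisCube (a : AmbientSpace n) (l : ℝ) :
    volume (axisCube a l) = ENNReal.ofReal l ^ (n + 1) := by
  have h : axisCube a l = (WithLp.ofLp : AmbientSpace n → Fin (n + 1) → ℝ) ⁻¹'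
      Icc (fun i => a i) (fun i => a i + l) := by
    ext z
    simp [axisCube, Pi.le_def, forall_and]
  rw [h, (PiLp.volume_preserving_ofLp _).measure_preimage measurableSet_Icc.nullMeasurableSet,
    Real.volume_Icc_pi]
  simp

theorem volume_le_volume_interior_axisCube (a : AmbientSpace n) (l : ℝ) :
    ENNReal.ofReal l ^ (n + 1) ≤ volume (interior (axisCube a l)) := by
  have hU : IsOpen ((WithLp.ofLp : AmbientSpace n → Fin (n + 1) → ℝ) ⁻¹'
      (univ.pi fun i => Ioo (a i) (a i + l))) :=
    (isOpen_set_pi finite_univ fun _ _ => isOpen_Ioo).preimage (PiLp.continuous_ofLp 2 _)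
  have hsub : ((WithLp.ofLp : AmbientSpace n → Fin (n + 1) → ℝ) ⁻¹'
      (univ.pi fun i => Ioo (a i) (a i + l))) ⊆ axisCube a l := fun z hz i => by
    have := hz i (mem_univ i)
    exact ⟨this.1.le, this.2.le⟩
  refine le_trans ?_ (measure_mono (interior_maximal hsub hU))
  rw [(PiLp.volume_preserving_ofLp _).measure_preimage
    (MeasurableSet.univ_pi fun _ => measurableSet_Ioo).nullMeasurableSet, Real.volume_pi_Ioo]
  simp

/-- The union of the balls centred in `A` whose radius is half the height of the centre. -/
def whitneyExpansion (A : Set (AmbientSpace n)) : Set (AmbientSpace n) :=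
  ⋃ w ∈ A, ball w (w (Fin.last n) / 2)

theorem isOpen_whitneyExpansion (A : Set (AmbientSpace n)) : IsOpen (whitneyExpansion A) :=
  isOpen_biUnion fun _ _ => isOpen_ball

/-- The expanded Whitney cubes have bounded overlap. -/
theorem IsWhitneyDecomposition.exists_tsum_indicator_le {Q : ℕ → Set (AmbientSpace n)}
    (hQ : IsWhitneyDecomposition Q) :
    ∃ N : NNReal, ∀ z, ∑' k, (whitneyExpansion (Q k)).indicator (fun _ => (1 : ENNReal)) z ≤ N := by
  obtain ⟨c, C, hc, hC, a, l, h⟩ := hQ.exists_axisCube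
  -- Overlap is bounded by volume counting. If the expansion of `Q k` contains a point `z` of height
  -- `t`, then `Q k` has side at least `A * t` and lies in the ball of radius `B * t` about `z`. The
  -- interiors being disjoint, at most `(B / A) ^ (n + 1) * V` cubes fit.
  set A : ℝ := c / (1 + C) * (2 / 3)
  set B : ℝ := 1 + √(n + 1) * (C * 2)
  have hA : 0 < A := by positivity
  have hB : 0 < B := by positivity
  set V := volume (ball (0 : AmbientSpace n) 1)
  have hV : V ≠ ⊤ := measure_ball_lt_top.ne
  have hAt : ENNReal.ofReal (A ^ (n + 1)) ≠ 0 := by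
    simpa using pow_pos hA _
  have hN : ENNReal.ofReal (B ^ (n + 1)) * V / ENNReal.ofReal (A ^ (n + 1)) ≠ ⊤ :=
    ENNReal.div_ne_top (ENNReal.mul_ne_top ENNReal.ofReal_ne_top hV) hAt
  refine ⟨(ENNReal.ofReal (B ^ (n + 1)) * V / ENNReal.ofReal (A ^ (n + 1))).toNNReal, fun z => ?_⟩
  rw [ENNReal.coe_toNNReal hN]
  have hloc : ∀ k, z ∈ whitneyExpansion (Q k) → 0 < z (Fin.last n) ∧
      A * z (Fin.last n) ≤ l k ∧ Q k ⊆ closedBall z (B * z (Fin.last n)) := by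
    intro k hz
    obtain ⟨w, hw, hzw⟩ := mem_iUnion₂.1 hz
    obtain ⟨hQk, hl, ha, h1, h2⟩ := h k
    rw [hQk] at hw
    have hw1 := hw (Fin.last n)
    set t := z (Fin.last n)
    set u := w (Fin.last n)
    have hd := (abs_apply_sub_le_dist z w (Fin.last n)).trans_lt hzw
    have hd1 := abs_lt.1 hd
    have hu : 0 < u := ha.trans_le hw1.1
    have ht1 : u < 2 * t := by linarith [hd1.1]
    have ht2 : 2 / 3 * t < u := by linarith [hd1.2]
    have ht : 0 < t := by linarith
    refine ⟨ht, ?_, fun v hv => ?_⟩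
    · have h3 : u ≤ (1 + C) * a k (Fin.last n) := by linarith [hw1.2]
      calc A * t = c / (1 + C) * (2 / 3 * t) := by simp only [A]; ring
        _ ≤ c / (1 + C) * ((1 + C) * a k (Fin.last n)) := by
            refine mul_le_mul_of_nonneg_left ?_ (by positivity)
            linarith
        _ = c * a k (Fin.last n) := by field_simp
        _ ≤ l k := h1
    · rw [hQk] at hv
      have h3 := dist_le_of_mem_axisCube hl.le hv hw
      have h4 : l k ≤ C * 2 * t := by
        calc l k ≤ C * a k (Fin.last n) := h2
          _ ≤ C * (2 * t) := by gcongr; linarith [hw1.1]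
          _ = _ := by ring
      have h5 : dist z w < u / 2 := hzw
      calc dist v z ≤ dist v w + dist z w := dist_triangle_right _ _ _
        _ ≤ √(n + 1) * l k + t := by linarith
        _ ≤ √(n + 1) * (C * 2 * t) + t := by gcongr
        _ = B * t := by simp only [B]; ring
  by_cases hz : 0 < z (Fin.last n)
  swap
  · have : ∀ k, (whitneyExpansion (Q k)).indicator (fun _ => (1 : ENNReal)) z = 0 := fun k =>
      indicator_of_notMem (fun hk => hz (hloc k hk).1) _
    simp [this]
  set t := z (Fin.last n)
  rw [ENNReal.le_div_iff_mul_le (Or.inl hAt) (Or.inl ENNReal.ofReal_ne_top)]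
  clear_value A B
  have hcube : ∀ k, (whitneyExpansion (Q k)).indicator (fun _ => (1 : ENNReal)) z *
      ENNReal.ofReal ((A * t) ^ (n + 1)) ≤
      volume (interior (Q k) ∩ closedBall z (B * t)) := by
    intro k
    by_cases hk : z ∈ whitneyExpansion (Q k)
    · rw [indicator_of_mem hk, one_mul]
      obtain ⟨-, h1, h2⟩ := hloc k hk
      rw [inter_eq_left.2 (interior_subset.trans h2), (h k).1, ENNReal.ofReal_pow (by positivity)]
      refine le_trans ?_ (volume_le_volume_interior_axisCube _ _)
      gcongr
    · simp [indicator_of_notMem hk]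
  have hsum : (∑' k, (whitneyExpansion (Q k)).indicator (fun _ => (1 : ENNReal)) z) *
      ENNReal.ofReal ((A * t) ^ (n + 1)) ≤ ENNReal.ofReal ((B * t) ^ (n + 1)) * V := by
    rw [← ENNReal.tsum_mul_right]
    calc _ ≤ ∑' k, volume (interior (Q k) ∩ closedBall z (B * t)) := ENNReal.tsum_le_tsum hcube
      _ = volume (⋃ k, interior (Q k) ∩ closedBall z (B * t)) := by
          rw [measure_iUnion]
          · intro i j hij
            exact (hQ.disjoint_interior i j hij).mono inter_subset_left inter_subset_left
          · exact fun k => isOpen_interior.measurableSet.inter measurableSet_closedBall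
      _ ≤ volume (closedBall z (B * t)) := measure_mono (iUnion_subset fun k => inter_subset_right)
      _ = _ := by
          rw [Measure.addHaar_closedBall _ _ (by positivity)]
          simp [V]
  have htn : ENNReal.ofReal (t ^ (n + 1)) ≠ 0 := by simpa using pow_pos hz _
  rw [mul_pow, mul_pow, ENNReal.ofReal_mul (by positivity), ENNReal.ofReal_mul (by positivity),
    ← mul_assoc, mul_right_comm (ENNReal.ofReal (B ^ (n + 1)))] at hsum
  exact (ENNReal.mul_le_mul_iff_left htn ENNReal.ofReal_ne_top).1 hsum

end WhitneyGeometry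

/-! ### Comparison and factorization for finite product measures. -/

section ProductMeasures

/-- Argued on outer measures, where the product is the largest one dominated on boxes by the
products of the factors; no finiteness is then needed. -/
theorem MeasureTheory.Measure.pi_mono_measure {ι : Type*} [Fintype ι] {α : ι → Type*}
    [∀ i, MeasurableSpace (α i)] {μ ν : ∀ i, Measure (α i)} (h : ∀ i, μ i ≤ ν i) :
    Measure.pi μ ≤ Measure.pi ν := by
  refine Measure.le_iff.2 fun A hA => ?_
  have : OuterMeasure.pi (fun i => (μ i).toOuterMeasure) ≤
      OuterMeasure.pi (fun i => (ν i).toOuterMeasure) :=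
    OuterMeasure.le_pi.2 fun s _ => (OuterMeasure.pi_pi_le _ s).trans
      (Finset.prod_le_prod' fun i _ => h i (s i))
  rw [Measure.pi, Measure.pi, toMeasure_apply _ _ hA, toMeasure_apply _ _ hA]
  exact this A

theorem MeasureTheory.Measure.pi_le_prod_smul_pi {ι : Type*} [Fintype ι] {α : ι → Type*}
    [∀ i, MeasurableSpace (α i)] {μ ν : ∀ i, Measure (α i)} [∀ i, SigmaFinite (ν i)]
    {c : ι → NNReal} (h : ∀ i, μ i ≤ c i • ν i) :
    Measure.pi μ ≤ (∏ i, c i) • Measure.pi ν := by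
  refine (Measure.pi_mono_measure h).trans_eq (Measure.pi_eq fun s _ => ?_)
  rw [Measure.smul_apply, Measure.pi_pi]
  simp only [Measure.smul_apply, ENNReal.smul_def, smul_eq_mul, Finset.prod_mul_distrib,
    ENNReal.ofNNReal_finsetProd]

theorem lintegral_fin_prod_eq_prod {N : ℕ} {E : Type*} [MeasurableSpace E]
    (μ : Fin N → Measure E) [∀ i, SigmaFinite (μ i)] (f : Fin N → E → ENNReal)
    (hf : ∀ i, AEMeasurable (f i) (μ i)) :
    ∫⁻ x, ∏ i, f i (x i) ∂(Measure.pi μ) = ∏ i, ∫⁻ x, f i x ∂(μ i) := by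
  induction N with
  | zero => simp
  | succ N ih =>
    have hmeas : AEMeasurable (fun x : Fin N → E => ∏ i : Fin N, f i.succ (x i))
        (Measure.pi fun i => μ i.succ) := by
      refine Finset.aemeasurable_fun_prod _ fun i _ => ?_
      exact (hf i.succ).comp_quasiMeasurePreserving
        (Measure.quasiMeasurePreserving_eval (μ := fun i : Fin N => μ i.succ) i)
    calc ∫⁻ x, ∏ i, f i (x i) ∂(Measure.pi μ)
        = ∫⁻ x : E × (Fin N → E), f 0 x.1 * ∏ i : Fin N, f i.succ (x.2 i)
            ∂((μ 0).prod (Measure.pi fun i => μ i.succ)) := by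
          refine Eq.trans ?_ ((measurePreserving_piFinSuccAbove μ 0).lintegral_comp_emb
            (MeasurableEquiv.measurableEmbedding _)
            fun x => f 0 x.1 * ∏ i : Fin N, f i.succ (x.2 i))
          refine lintegral_congr fun x => ?_
          rw [Fin.prod_univ_succ]
          rfl
      _ = (∫⁻ x, f 0 x ∂μ 0) * ∏ i : Fin N, ∫⁻ x, f i.succ x ∂(μ i.succ) := by
          rw [lintegral_prod_mul (hf 0) hmeas, ih _ _ fun i => hf i.succ]
      _ = _ := by rw [Fin.prod_univ_succ]

end ProductMeasures

/-! ### Local comparison of the weighted measures with Lebesgue measure. -/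

section WeightedMeasures

variable {n m : ℕ}

instance sigmaFinite_weightedMeasure (r : ℝ) : SigmaFinite (weightedMeasure n r) := by
  unfold weightedMeasure; infer_instance

theorem measurable_height_rpow (r : ℝ) :
    Measurable fun z : AmbientSpace n => ENNReal.ofReal (z (Fin.last n) ^ r) := by
  fun_prop

theorem ball_half_height_subset {w z : AmbientSpace n} (hz : z ∈ ball w (w (Fin.last n) / 2)) :
    w (Fin.last n) / 2 < z (Fin.last n) ∧ z (Fin.last n) < 2 * w (Fin.last n) := by
  have h1 : dist z w < w (Fin.last n) / 2 := hz
  have h0 := (dist_nonneg (x := z) (y := w)).trans_lt h1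
  have h2 := abs_lt.1 ((abs_apply_sub_le_dist z w (Fin.last n)).trans_lt h1)
  constructor <;> linarith [h2.1, h2.2]

/-- The absolute value in the exponent covers both signs of `r`, since the weight may blow up or
vanish at the boundary. -/
theorem rpow_le_two_rpow_abs_mul {r t u : ℝ} (ht : 0 < t) (h1 : t / 2 ≤ u) (h2 : u ≤ 2 * t) :
    t ^ r ≤ 2 ^ |r| * u ^ r := by
  have hu : 0 < u := by linarith
  rcases le_total 0 r with hr | hr
  · rw [abs_of_nonneg hr, ← Real.mul_rpow zero_le_two hu.le]
    exact Real.rpow_le_rpow ht.le (by linarith) hr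
  · rw [abs_of_nonpos hr, Real.rpow_neg zero_le_two, ← Real.inv_rpow zero_le_two,
      ← Real.mul_rpow (by norm_num) hu.le]
    exact Real.rpow_le_rpow_of_nonpos (by positivity) (by linarith) hr

/-- On a ball of radius half the height of its centre, the weight is almost constant. -/
theorem volume_restrict_ball_le (r : ℝ) {w : AmbientSpace n} (hw : 0 < w (Fin.last n)) :
    volume.restrict (ball w (w (Fin.last n) / 2)) ≤
      (2 ^ |r| * w (Fin.last n) ^ (-r)).toNNReal •
        (weightedMeasure n r).restrict (ball w (w (Fin.last n) / 2)) := by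
  set t := w (Fin.last n)
  set B := ball w (t / 2)
  have hB : MeasurableSet B := measurableSet_ball
  have hsub : B ⊆ upperHalfSpace n := fun z hz => by
    rw [mem_upperHalfSpace]
    linarith [(ball_half_height_subset hz).1]
  refine Measure.le_iff.2 fun A hA => ?_
  rw [Measure.smul_apply, Measure.restrict_apply hA, Measure.restrict_apply hA, weightedMeasure,
    withDensity_apply _ (hA.inter hB), Measure.restrict_restrict (hA.inter hB),
    inter_eq_left.2 (inter_subset_right.trans hsub), ENNReal.smul_def, smul_eq_mul,
    ← lintegral_const_mul _ (measurable_height_rpow r), ← setLIntegral_one]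
  refine setLIntegral_mono ((measurable_height_rpow r).const_mul _) fun z hz => ?_
  obtain ⟨h1, h2⟩ := ball_half_height_subset hz.2
  have hzt : 0 < z (Fin.last n) := by linarith
  change 1 ≤ ENNReal.ofReal (2 ^ |r| * t ^ (-r)) * _
  rw [← ENNReal.ofReal_mul (by positivity), ENNReal.one_le_ofReal]
  have h3 := rpow_le_two_rpow_abs_mul (r := r) hw h1.le h2.le
  calc (1 : ℝ) = t ^ (-r) * t ^ r := by rw [← Real.rpow_add hw]; simp
    _ ≤ t ^ (-r) * (2 ^ |r| * z (Fin.last n) ^ r) := by gcongr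
    _ = _ := by ring

theorem prod_toNNReal_weight (s : Fin m → ℝ) {t : ℝ} (ht : 0 < t) :
    ∏ j, (2 ^ |s j| * t ^ (-s j)).toNNReal = (2 ^ (∑ j, |s j|) * t ^ (-∑ j, s j)).toNNReal := by
  rw [← Real.toNNReal_prod_of_nonneg fun j _ => by positivity, Finset.prod_mul_distrib,
    ← Real.rpow_sum_of_pos zero_lt_two, ← Real.rpow_sum_of_pos ht, Finset.sum_neg_distrib]

theorem setLIntegral_pi_ball_le (s : Fin m → ℝ) {w : AmbientSpace n} (hw : 0 < w (Fin.last n))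
    (g : (Fin m → AmbientSpace n) → ENNReal) :
    ∫⁻ z in univ.pi fun _ => ball w (w (Fin.last n) / 2), g z
        ∂(Measure.pi fun _ : Fin m => (volume : Measure (AmbientSpace n))) ≤
      ENNReal.ofReal (2 ^ (∑ j, |s j|) * w (Fin.last n) ^ (-∑ j, s j)) *
        ∫⁻ z in univ.pi fun _ => ball w (w (Fin.last n) / 2), g z
          ∂(productWeightedMeasure n s) := by
  have h := Measure.pi_le_prod_smul_pi fun j => volume_restrict_ball_le (s j) hw
  rw [prod_toNNReal_weight s hw] at h
  rw [productWeightedMeasure, Measure.restrict_pi_pi, Measure.restrict_pi_pi]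
  refine (lintegral_mono' h le_rfl).trans_eq ?_
  rw [lintegral_smul_measure]
  rfl

end WeightedMeasures

/-! ### From the Carleson condition to the trace inequality. -/

section CarlesonImpliesTrace

variable {n m : ℕ}

theorem eLpNorm_ofReal_rpow {α : Type*} [MeasurableSpace α] {p : ℝ} (hp : 0 < p) (f : α → ℂ)
    (μ : Measure α) : eLpNorm f (ENNReal.ofReal p) μ ^ p = ∫⁻ z, ‖f z‖ₑ ^ p ∂μ := by
  rw [eLpNorm_eq_lintegral_rpow_enorm_toReal (by simpa using hp) ENNReal.ofReal_ne_top,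
    ENNReal.toReal_ofReal hp.le, ← ENNReal.rpow_mul, one_div, inv_mul_cancel₀ hp.ne',
    ENNReal.rpow_one]

/-- The degree of homogeneity `(n + 1) m + ∑ s_j` of the measure `dm_{s_1} ⋯ dm_{s_m}`. -/
def carlesonExponent (n : ℕ) {m : ℕ} (s : Fin m → ℝ) : ℝ := (n + 1) * m + ∑ j, s j

theorem carlesonExponent_eq_sum (s : Fin m → ℝ) :
    carlesonExponent n s = ∑ j, ((n : ℝ) + 1 + s j) := by
  simp [carlesonExponent, Finset.sum_add_distrib]; ring

theorem carlesonExponent_nonneg {s : Fin m → ℝ} (hs : ∀ j, -1 < s j) :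
    0 ≤ carlesonExponent n s := by
  rw [carlesonExponent_eq_sum]
  refine Finset.sum_nonneg fun j _ => ?_
  have := hs j
  have : (0 : ℝ) ≤ n := n.cast_nonneg
  linarith

theorem volume_axisCube_rpow (s : Fin m → ℝ) (a : AmbientSpace n) {l : ℝ} (hl : 0 < l) :
    volume (axisCube a l) ^ ((m : ℝ) + (∑ j, s j) / ((n : ℝ) + 1)) =
      ENNReal.ofReal (l ^ carlesonExponent n s) := by
  have hn : (0 : ℝ) < n + 1 := by positivity
  rw [volume_axisCube, ← ENNReal.ofReal_pow hl.le, ENNReal.ofReal_rpow_of_pos (by positivity),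
    ← Real.rpow_natCast, ← Real.rpow_mul hl.le]
  congr 2
  push_cast
  rw [carlesonExponent]
  field_simp

theorem measurableEmbedding_toLp :
    MeasurableEmbedding (WithLp.toLp 2 : (Fin m → AmbientSpace n) → _) :=
  ((PiLp.continuousLinearEquiv 2 ℝ fun _ : Fin m => AmbientSpace n).symm.toHomeomorph
    ).measurableEmbedding

/-- Pointwise bound of the trace of a harmonic function by a local integral. -/
theorem exists_enorm_trace_rpow_le {p : ℝ} (hp : 0 < p) (s : Fin m → ℝ) :
    ∃ C : NNReal, ∀ f : (Fin m → AmbientSpace n) → ℂ, IsJointlyHarmonic f →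
      ∀ w ∈ upperHalfSpace n, ‖diagonalTrace f w‖ₑ ^ p ≤
        C * ENNReal.ofReal (w (Fin.last n) ^ (-carlesonExponent n s)) *
          ∫⁻ z in univ.pi fun _ => ball w (w (Fin.last n) / 2), ‖f z‖ₑ ^ p
            ∂(productWeightedMeasure n s) := by
  set e := (PiLp.continuousLinearEquiv 2 ℝ fun _ : Fin m => AmbientSpace n).symm
  set π : Measure (Fin m → AmbientSpace n) := Measure.pi fun _ => volume
  -- Joint harmonicity refers to the Euclidean norm, the integrals to the plain product.
  -- Transporting product Lebesgue measure gives some Haar measure, and its normalization only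
  -- affects constants.
  have hHaar : (π.map e).IsAddHaarMeasure := ContinuousLinearEquiv.isAddHaarMeasure_map e π
  obtain ⟨C, hC⟩ := exists_enorm_rpow_le_setLIntegral_of_harmonic (π.map e) hp
  have hrank : Module.finrank ℝ (PiLp 2 fun _ : Fin m => AmbientSpace n) = (n + 1) * m := by
    rw [← LinearEquiv.finrank_eq e.toLinearEquiv, Module.finrank_pi_fintype]
    simp [mul_comm]
  rw [hrank] at hC
  -- The power of `4` comes from the radius `t / 4`, the power of `2` from the oscillation of the
  -- weights.
  set K : ℝ := 4 ^ ((n + 1) * m) * 2 ^ (∑ j, |s j|)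
  refine ⟨C * K.toNNReal, fun f hf w hw => ?_⟩
  set t := w (Fin.last n)
  have ht : 0 < t := hw
  have hcoord : ∀ z ∈ closedBall (e fun _ => w) (t / 4), ∀ j, z j ∈ ball w (t / 2) := by
    intro z hz j
    have h1 : dist (z j) w ≤ dist z (e fun _ => w) := by
      rw [dist_eq_norm, dist_eq_norm]
      exact PiLp.norm_apply_le (z - e fun _ => w) j
    rw [mem_ball]
    linarith [mem_closedBall.1 hz]
  have hharm : HarmonicOnNhd
      (fun z : PiLp 2 (fun _ : Fin m => AmbientSpace n) => f (WithLp.ofLp z))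
      (closedBall (e fun _ => w) (t / 4)) := by
    refine hf.mono fun z hz j => ?_
    rw [mem_upperHalfSpace]
    linarith [(ball_half_height_subset (hcoord z hz j)).1]
  have h1 := hC _ _ (t / 4) (by positivity) hharm
  have hemb : MeasurableEmbedding e := measurableEmbedding_toLp
  rw [hemb.restrict_map, hemb.lintegral_map] at h1
  have h2 : ∫⁻ z in e ⁻¹' closedBall (e fun _ => w) (t / 4), ‖f z‖ₑ ^ p ∂π ≤
      ∫⁻ z in univ.pi fun _ => ball w (t / 2), ‖f z‖ₑ ^ p ∂π :=
    lintegral_mono_set fun z hz j _ => hcoord (e z) hz j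
  have h3 := h2.trans (setLIntegral_pi_ball_le s hw fun z => ‖f z‖ₑ ^ p)
  set J := ∫⁻ z in univ.pi fun _ => ball w (t / 2), ‖f z‖ₑ ^ p ∂(productWeightedMeasure n s)
  have h4 : ENNReal.ofReal (t / 4) ^ ((n + 1) * m) * ‖diagonalTrace f w‖ₑ ^ p ≤
      C * (ENNReal.ofReal (2 ^ (∑ j, |s j|) * t ^ (-∑ j, s j)) * J) :=
    h1.trans (mul_le_mul_right h3 _)
  have h5 : ENNReal.ofReal ((4 / t) ^ ((n + 1) * m)) * ENNReal.ofReal (t / 4) ^ ((n + 1) * m) =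
      1 := by
    rw [← ENNReal.ofReal_pow (by positivity), ← ENNReal.ofReal_mul (by positivity), ← mul_pow]
    rw [div_mul_div_comm, mul_comm, div_self (by positivity)]
    simp
  have h6 : (4 / t) ^ ((n + 1) * m) * (2 ^ (∑ j, |s j|) * t ^ (-∑ j, s j)) =
      K * t ^ (-carlesonExponent n s) := by
    rw [carlesonExponent, neg_add, Real.rpow_add ht, Real.rpow_neg ht.le ((n + 1) * m), div_pow]
    have : t ^ (((n : ℝ) + 1) * m) = t ^ ((n + 1) * m) := by
      rw [← Real.rpow_natCast]; push_cast; rfl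
    rw [this]
    simp only [K]
    field_simp
  calc ‖diagonalTrace f w‖ₑ ^ p
      = ENNReal.ofReal ((4 / t) ^ ((n + 1) * m)) *
          (ENNReal.ofReal (t / 4) ^ ((n + 1) * m) * ‖diagonalTrace f w‖ₑ ^ p) := by
        rw [← mul_assoc, h5, one_mul]
    _ ≤ ENNReal.ofReal ((4 / t) ^ ((n + 1) * m)) *
          (C * (ENNReal.ofReal (2 ^ (∑ j, |s j|) * t ^ (-∑ j, s j)) * J)) :=
        mul_le_mul_right h4 _
    _ = C * (ENNReal.ofReal ((4 / t) ^ ((n + 1) * m)) *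
          ENNReal.ofReal (2 ^ (∑ j, |s j|) * t ^ (-∑ j, s j))) * J := by ring
    _ = _ := by
        rw [← ENNReal.ofReal_mul (by positivity), h6, ENNReal.ofReal_mul (by positivity)]
        simp only [ENNReal.coe_mul, mul_assoc]
        rfl

theorem continuousOn_diagonalTrace {f : (Fin m → AmbientSpace n) → ℂ} (hf : IsJointlyHarmonic f) :
    ContinuousOn (diagonalTrace f) (upperHalfSpace n) := by
  have h : Continuous fun w : AmbientSpace n =>
      (WithLp.toLp 2 (fun _ => w) : PiLp 2 fun _ : Fin m => AmbientSpace n) := by fun_prop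
  exact (HarmonicOnNhd.continuousOn hf).comp h.continuousOn fun w hw _ => hw

/-- The Carleson condition implies boundedness of the trace operator. -/
theorem traceBounded_of_carleson (hm : 1 ≤ m) {Q : ℕ → Set (AmbientSpace n)}
    (hQ : IsWhitneyDecomposition Q) {p : ℝ} (hp : 0 < p) {s : Fin m → ℝ} (hs : ∀ j, -1 < s j)
    {μ : Measure (AmbientSpace n)} {C₀ : NNReal}
    (hμ : ∀ k, μ (Q k) / volume (Q k) ^ ((m : ℝ) + (∑ j, s j) / ((n : ℝ) + 1)) ≤ C₀) :
    TraceBounded p s μ (productBergmanSpace n p s) := by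
  obtain ⟨C₁, hC₁⟩ := exists_enorm_trace_rpow_le (n := n) hp s
  obtain ⟨c, C₂, hc, hC₂, a, l, h⟩ := hQ.exists_axisCube
  obtain ⟨N, hN⟩ := hQ.exists_tsum_indicator_le
  set E := carlesonExponent n s
  have hE : 0 ≤ E := carlesonExponent_nonneg hs
  set K : NNReal := C₁ * (C₂ ^ E).toNNReal * C₀
  refine ⟨(K * N) ^ (1 / p), fun f hf => ?_⟩
  obtain ⟨hharm, hmem⟩ := hf
  set M := productWeightedMeasure n s
  set g : (Fin m → AmbientSpace n) → ENNReal := fun z => ‖f z‖ₑ ^ p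
  have hg : AEMeasurable g M := hmem.1.enorm.pow_const p
  have hcube : ∀ k, ∫⁻ w in Q k, ‖diagonalTrace f w‖ₑ ^ p ∂μ ≤
      K * ∫⁻ z in univ.pi fun _ => whitneyExpansion (Q k), g z ∂M := by
    intro k
    obtain ⟨hQk, hl, ha, h1, h2⟩ := h k
    set J := ∫⁻ z in univ.pi fun _ => whitneyExpansion (Q k), g z ∂M
    have hle : l k ^ E ≠ 0 := (by positivity : 0 < l k ^ E).ne'
    -- As `w` is at least as high as the lower face, its height is at least `l k / C₂`; since `E ≥
    -- 0`, this bounds the height to the power `-E` by `C₂ ^ E * (l k ^ E)⁻¹`.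
    have hpt : ∀ w ∈ Q k, ‖diagonalTrace f w‖ₑ ^ p ≤
        C₁ * ENNReal.ofReal (C₂ ^ E * (l k ^ E)⁻¹) * J := by
      intro w hw
      have hwa : a k (Fin.last n) ≤ w (Fin.last n) := by
        rw [hQk] at hw; exact (hw _).1
      have hwU : w ∈ upperHalfSpace n := ha.trans_le hwa
      refine (hC₁ f hharm w hwU).trans ?_
      gcongr
      · rw [Real.rpow_neg (ha.trans_le hwa).le, ← div_eq_mul_inv, ← Real.div_rpow hC₂.le hl.le,
          ← Real.inv_rpow (ha.trans_le hwa).le]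
        refine Real.rpow_le_rpow (inv_nonneg.2 (ha.trans_le hwa).le) ?_ hE
        rw [inv_eq_one_div, div_le_div_iff₀ (ha.trans_le hwa) hl, one_mul]
        exact h2.trans (by gcongr)
      · refine lintegral_mono_set (pi_mono fun j _ => ?_)
        exact subset_biUnion_of_mem (u := fun w => ball w (w (Fin.last n) / 2)) hw
    have hμk : μ (Q k) ≤ C₀ * ENNReal.ofReal (l k ^ E) := by
      have := hμ k
      rw [hQk, volume_axisCube_rpow s _ hl] at this
      rw [hQk]
      exact (ENNReal.div_le_iff (by simpa using (by positivity : 0 < l k ^ E))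
        ENNReal.ofReal_ne_top).1 this
    calc ∫⁻ w in Q k, ‖diagonalTrace f w‖ₑ ^ p ∂μ
        ≤ ∫⁻ _ in Q k, C₁ * ENNReal.ofReal (C₂ ^ E * (l k ^ E)⁻¹) * J ∂μ :=
          setLIntegral_mono measurable_const hpt
      _ = C₁ * ENNReal.ofReal (C₂ ^ E * (l k ^ E)⁻¹) * J * μ (Q k) := setLIntegral_const _ _
      _ ≤ C₁ * ENNReal.ofReal (C₂ ^ E * (l k ^ E)⁻¹) * J * (C₀ * ENNReal.ofReal (l k ^ E)) := by
          gcongr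
      _ = C₁ * (ENNReal.ofReal (C₂ ^ E * (l k ^ E)⁻¹) * ENNReal.ofReal (l k ^ E)) * C₀ * J := by
          ring
      _ = K * J := by
          rw [← ENNReal.ofReal_mul (by positivity), inv_mul_cancel_right₀ hle]
          simp only [K, ENNReal.coe_mul]
          rfl
  have hmeas : ∀ k, MeasurableSet (univ.pi fun _ : Fin m => whitneyExpansion (Q k)) := fun k =>
    MeasurableSet.univ_pi fun _ => (isOpen_whitneyExpansion _).measurableSet
  have hmain : ∫⁻ w in upperHalfSpace n, ‖diagonalTrace f w‖ₑ ^ p ∂μ ≤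
      (K * N : NNReal) * ∫⁻ z, g z ∂M := by
    calc ∫⁻ w in upperHalfSpace n, ‖diagonalTrace f w‖ₑ ^ p ∂μ
        ≤ ∑' k, ∫⁻ w in Q k, ‖diagonalTrace f w‖ₑ ^ p ∂μ := by
          rw [← hQ.iUnion_eq]; exact lintegral_iUnion_le _ _
      _ ≤ ∑' k, K * ∫⁻ z in univ.pi fun _ => whitneyExpansion (Q k), g z ∂M :=
          ENNReal.tsum_le_tsum hcube
      _ = K * ∑' k, ∫⁻ z, (univ.pi fun _ => whitneyExpansion (Q k)).indicator g z ∂M := by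
          rw [ENNReal.tsum_mul_left]
          simp_rw [lintegral_indicator (hmeas _)]
      _ = K * ∫⁻ z, ∑' k, (univ.pi fun _ => whitneyExpansion (Q k)).indicator g z ∂M := by
          rw [lintegral_tsum fun k => hg.indicator (hmeas k)]
      _ ≤ K * ∫⁻ z, N * g z ∂M := by
          refine mul_le_mul_right (lintegral_mono fun z => ?_) _
          -- Overlap in a single coordinate already bounds the overlap of the product sets; this is
          -- where `1 ≤ m` enters.
          let j₀ : Fin m := ⟨0, hm⟩
          calc ∑' k, (univ.pi fun _ => whitneyExpansion (Q k)).indicator g z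
              ≤ ∑' k, (whitneyExpansion (Q k)).indicator (fun _ => (1 : ENNReal)) (z j₀) * g z := by
                refine ENNReal.tsum_le_tsum fun k => ?_
                by_cases hz : z ∈ univ.pi fun _ => whitneyExpansion (Q k)
                · rw [indicator_of_mem hz, indicator_of_mem (hz j₀ (mem_univ _)), one_mul]
                · rw [indicator_of_notMem hz]; exact zero_le
            _ ≤ N * g z := by
                rw [ENNReal.tsum_mul_right]
                exact mul_le_mul_left (hN _) _
      _ = _ := by
          rw [lintegral_const_mul'' _ hg, ← mul_assoc, ← ENNReal.coe_mul]
  have hnorm : eLpNorm (diagonalTrace f) (ENNReal.ofReal p) (μ.restrict (upperHalfSpace n)) ≤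
      ((K * N) ^ (1 / p) : NNReal) * eLpNorm f (ENNReal.ofReal p) M := by
    rw [← ENNReal.rpow_le_rpow_iff hp, ENNReal.mul_rpow_of_nonneg _ _ hp.le,
      eLpNorm_ofReal_rpow hp, eLpNorm_ofReal_rpow hp, ← ENNReal.coe_rpow_of_nonneg _ hp.le,
      ← NNReal.rpow_mul, one_div, inv_mul_cancel₀ hp.ne', NNReal.rpow_one]
    exact hmain
  refine ⟨⟨?_, ?_⟩, hnorm⟩
  · exact (continuousOn_diagonalTrace hharm).aestronglyMeasurable
      isOpen_upperHalfSpace.measurableSet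
  · exact hnorm.trans_lt (ENNReal.mul_lt_top ENNReal.coe_lt_top hmem.2)

end CarlesonImpliesTrace

/-! ### The Laplacian through second derivatives along lines. -/

section LaplacianAlongLines

variable {E : Type*} [NormedAddCommGroup E] [InnerProductSpace ℝ E] {f : E → ℂ} {x : E}

theorem ContDiffAt.iteratedFDeriv_two_eq_deriv_deriv (hf : ContDiffAt ℝ 2 f x) (v : E) :
    iteratedFDeriv ℝ 2 f x ![v, v] = deriv (deriv fun τ : ℝ => f (x + τ • v)) 0 := by
  have hline : ∀ τ : ℝ, HasDerivAt (fun τ : ℝ => x + τ • v) v τ := fun τ => by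
    simpa using ((hasDerivAt_id τ).smul_const v).const_add x
  have htend : Tendsto (fun τ : ℝ => x + τ • v) (𝓝 0) (𝓝 x) := by
    simpa using (hline 0).continuousAt.tendsto
  have hev : (deriv fun τ : ℝ => f (x + τ • v)) =ᶠ[𝓝 0] fun τ => fderiv ℝ f (x + τ • v) v := by
    filter_upwards [htend.eventually (hf.eventually (by simp))] with τ hτ
    exact ((hτ.differentiableAt (by norm_num)).hasFDerivAt.comp_hasDerivAt τ (hline τ)).deriv
  have hD : HasFDerivAt (fderiv ℝ f) (fderiv ℝ (fderiv ℝ f) x) (x + (0 : ℝ) • v) := by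
    rw [zero_smul, add_zero]
    exact ((hf.fderiv_right (m := 1) (by norm_num)).differentiableAt (by norm_num)).hasFDerivAt
  have h2 := hD.comp_hasDerivAt (0 : ℝ) (hline 0)
  have h3 := (ContinuousLinearMap.apply ℝ ℂ v).hasFDerivAt.comp_hasDerivAt (0 : ℝ) h2
  rw [hev.deriv_eq, iteratedFDeriv_two_apply]
  exact h3.deriv.symm

theorem ContDiffAt.laplacian_eq_sum_deriv_deriv [FiniteDimensional ℝ E] {ι : Type*} [Fintype ι]
    (b : OrthonormalBasis ι ℝ E) (hf : ContDiffAt ℝ 2 f x) :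
    (Δ f) x = ∑ i, deriv (deriv fun τ : ℝ => f (x + τ • b i)) 0 := by
  rw [laplacian_eq_iteratedFDeriv_orthonormalBasis f b]
  exact Finset.sum_congr rfl fun i _ => hf.iteratedFDeriv_two_eq_deriv_deriv (b i)

end LaplacianAlongLines

/-! ### Products of harmonic functions, and the product inequality. -/

section TensorProducts

variable {n m : ℕ}

theorem isOpen_productDomain :
    IsOpen {z : PiLp 2 (fun _ : Fin m => AmbientSpace n) | ∀ j, z j ∈ upperHalfSpace n} := by
  simp only [ofPred_forall]
  exact isOpen_iInter_of_finite fun j => isOpen_upperHalfSpace.preimage (by fun_prop)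

/-- In an orthonormal basis adapted to the factors, a move in a direction of the `j`-th factor
changes only `f j`. The Laplacian is thus the sum over `j` of `Δ (f j)` times the other factors. -/
theorem isJointlyHarmonic_prod {f : Fin m → AmbientSpace n → ℂ}
    (hf : ∀ j, HarmonicOnNhd (f j) (upperHalfSpace n)) :
    IsJointlyHarmonic fun z : Fin m → AmbientSpace n => ∏ j, f j (z j) := by
  have hcd : ∀ z : PiLp 2 (fun _ : Fin m => AmbientSpace n), (∀ j, z j ∈ upperHalfSpace n) →
      ContDiffAt ℝ 2 (fun z : PiLp 2 (fun _ : Fin m => AmbientSpace n) => ∏ j, f j (z j)) z := by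
    intro z hz
    refine contDiffAt_prod fun j _ => ?_
    have h1 : ContDiffAt ℝ 2 (fun z : PiLp 2 (fun _ : Fin m => AmbientSpace n) => z j) z := by
      fun_prop
    exact (hf j (z j) (hz j)).1.comp z h1
  intro z hz
  refine ⟨hcd z hz, ?_⟩
  filter_upwards [isOpen_productDomain.mem_nhds hz] with z hz
  rw [(hcd z hz).laplacian_eq_sum_deriv_deriv
    (Pi.orthonormalBasis fun _ => EuclideanSpace.basisFun (Fin (n + 1)) ℝ), Fintype.sum_sigma]
  refine Finset.sum_eq_zero fun j _ => ?_
  have hj := (hf j (z j) (hz j)).2.eq_of_nhds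
  rw [(hf j (z j) (hz j)).1.laplacian_eq_sum_deriv_deriv
    (EuclideanSpace.basisFun (Fin (n + 1)) ℝ)] at hj
  have hline : ∀ i, (fun τ : ℝ => ∏ k, f k ((z + τ • Pi.orthonormalBasis
        (fun _ : Fin m => EuclideanSpace.basisFun (Fin (n + 1)) ℝ) ⟨j, i⟩) k)) =
      fun τ => (∏ k ∈ Finset.univ.erase j, f k (z k)) *
        f j (z j + τ • EuclideanSpace.basisFun (Fin (n + 1)) ℝ i) := by
    intro i
    funext τ
    rw [← Finset.prod_erase_mul _ _ (Finset.mem_univ j)]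
    congr 1
    · refine Finset.prod_congr rfl fun k hk => ?_
      have hkj := Finset.ne_of_mem_erase hk
      simp [hkj]
    · simp
  simp only [hline, deriv_const_mul_field', deriv_const_mul_field]
  rw [← Finset.mul_sum, hj]
  simp

theorem isSeparatelyHarmonic_prod {f : Fin m → AmbientSpace n → ℂ}
    (hf : ∀ j, HarmonicOnNhd (f j) (upperHalfSpace n)) :
    IsSeparatelyHarmonic fun z : Fin m → AmbientSpace n => ∏ j, f j (z j) := by
  intro z _ j
  have h : (fun w => ∏ k, f k (Function.update z j w k)) =
      (ContinuousLinearMap.mul ℝ ℂ (∏ k ∈ Finset.univ.erase j, f k (z k))) ∘ f j := by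
    funext w
    rw [← Finset.prod_erase_mul _ _ (Finset.mem_univ j)]
    simp only [Function.comp, ContinuousLinearMap.mul_apply', Function.update_self]
    congr 1
    refine Finset.prod_congr rfl fun k hk => ?_
    rw [Function.update_of_ne (Finset.ne_of_mem_erase hk)]
  rw [h]
  exact (hf j).comp_CLM _

theorem enorm_prod_complex {ι : Type*} (t : Finset ι) (a : ι → ℂ) :
    ‖∏ j ∈ t, a j‖ₑ = ∏ j ∈ t, ‖a j‖ₑ := by
  simp only [enorm_eq_nnnorm, nnnorm_prod, ENNReal.ofNNReal_finsetProd]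

theorem lintegral_enorm_prod_rpow {p : ℝ} (hp : 0 < p) (s : Fin m → ℝ)
    {f : Fin m → AmbientSpace n → ℂ} (hf : ∀ j, f j ∈ bergmanSpace n p (s j)) :
    ∫⁻ z, ‖∏ j, f j (z j)‖ₑ ^ p ∂(productWeightedMeasure n s) =
      ∏ j, eLpNorm (f j) (ENNReal.ofReal p) (weightedMeasure n (s j)) ^ p := by
  simp only [enorm_prod_complex, eLpNorm_ofReal_rpow hp]
  rw [productWeightedMeasure, ← lintegral_fin_prod_eq_prod (fun j => weightedMeasure n (s j))
    (fun j z => ‖f j z‖ₑ ^ p) fun j => (hf j).2.1.enorm.pow_const p]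
  refine lintegral_congr fun z => ?_
  exact ENNReal.prod_rpow_of_nonneg hp.le |>.symm

theorem prod_mem_separateBergmanSpace {p : ℝ} (hp : 0 < p) {s : Fin m → ℝ}
    {f : Fin m → AmbientSpace n → ℂ} (hf : ∀ j, f j ∈ bergmanSpace n p (s j)) :
    (fun z : Fin m → AmbientSpace n => ∏ j, f j (z j)) ∈ separateBergmanSpace n p s := by
  refine ⟨⟨isJointlyHarmonic_prod fun j => (hf j).1, ?_, ?_⟩,
    isSeparatelyHarmonic_prod fun j => (hf j).1⟩
  · refine Finset.aestronglyMeasurable_fun_prod _ fun j _ => ?_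
    exact (hf j).2.1.comp_quasiMeasurePreserving
      (Measure.quasiMeasurePreserving_eval (μ := fun j => weightedMeasure n (s j)) j)
  · rw [← ENNReal.rpow_lt_top_iff_of_pos hp, eLpNorm_ofReal_rpow hp,
      lintegral_enorm_prod_rpow hp s hf]
    exact ENNReal.prod_lt_top fun j _ => (ENNReal.rpow_lt_top_iff_of_pos hp).2 (hf j).2.2

/-- Boundedness of the trace on separately harmonic functions implies the product inequality. -/
theorem exists_product_inequality_of_traceBounded {p : ℝ} (hp : 0 < p) {s : Fin m → ℝ}
    {μ : Measure (AmbientSpace n)} (h : TraceBounded p s μ (separateBergmanSpace n p s)) :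
    ∃ C : NNReal, ∀ f : Fin m → AmbientSpace n → ℂ, (∀ j, f j ∈ bergmanSpace n p (s j)) →
      ∫⁻ z in upperHalfSpace n, ∏ j, ‖f j z‖ₑ ^ p ∂μ ≤
        C * ∏ j, (eLpNorm (f j) (ENNReal.ofReal p) (weightedMeasure n (s j))) ^ p := by
  obtain ⟨C, hC⟩ := h
  refine ⟨C ^ p, fun f hf => ?_⟩
  have h1 := ENNReal.rpow_le_rpow (hC _ (prod_mem_separateBergmanSpace hp hf)).2 hp.le
  rw [ENNReal.mul_rpow_of_nonneg _ _ hp.le, eLpNorm_ofReal_rpow hp, eLpNorm_ofReal_rpow hp,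
    lintegral_enorm_prod_rpow hp s hf, ← ENNReal.coe_rpow_of_nonneg _ hp.le] at h1
  refine (lintegral_congr fun z => ?_).trans_le h1
  simp only [diagonalTrace, enorm_prod_complex]
  exact ENNReal.prod_rpow_of_nonneg hp.le

end TensorProducts

/-! ### A decaying harmonic kernel without zeros in the half space. -/

section HarmonicKernel

/-- The kernel along the line `u + τ e` with `e` a unit vector: `ζ` and `ω` are the values of the
null functional at `u` and `e`, `q` is `‖u‖ ^ 2` and `c` is the inner product of `u` and `e`. -/
theorem deriv_deriv_pow_mul_rpow (ζ ω : ℂ) (N : ℕ) {q : ℝ} (hq : 0 < q) (c κ : ℝ) :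
    deriv (deriv fun τ : ℝ => (ζ + τ * ω) ^ (N + 2) *
        (((q + 2 * τ * c + τ ^ 2) ^ (-κ) : ℝ) : ℂ)) 0 =
      (N + 2) * (N + 1) * ζ ^ N * (q ^ (-κ) : ℝ) * ω ^ 2 -
        4 * κ * (N + 2) * ζ ^ (N + 1) * (q ^ (-κ - 1) : ℝ) * (ω * c) +
        4 * κ * (κ + 1) * ζ ^ (N + 2) * (q ^ (-κ - 2) : ℝ) * (c : ℂ) ^ 2 -
        2 * κ * ζ ^ (N + 2) * (q ^ (-κ - 1) : ℝ) := by
  have hlin : ∀ τ : ℝ, HasDerivAt (fun τ : ℝ => ζ + τ * ω) ω τ := fun τ => by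
    simpa using ((Complex.ofRealCLM.hasDerivAt (x := τ)).mul_const ω).const_add ζ
  have hpow : ∀ (k : ℕ) (τ : ℝ), HasDerivAt (fun τ : ℝ => (ζ + τ * ω) ^ (k + 1))
      ((k + 1) * (ζ + τ * ω) ^ k * ω) τ := fun k τ => by
    simpa using (hlin τ).fun_pow (k + 1)
  have hquad : ∀ τ : ℝ, HasDerivAt (fun τ : ℝ => q + 2 * τ * c + τ ^ 2) (2 * c + 2 * τ) τ := by
    intro τ
    have h1 := (((hasDerivAt_id τ).const_mul 2).mul_const c).const_add q
    have h2 := h1.fun_add (hasDerivAt_pow 2 τ)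
    simpa using h2
  have hrpow : ∀ (r τ : ℝ), 0 < q + 2 * τ * c + τ ^ 2 →
      HasDerivAt (fun τ : ℝ => (((q + 2 * τ * c + τ ^ 2) ^ r : ℝ) : ℂ))
        (((2 * c + 2 * τ) * r * (q + 2 * τ * c + τ ^ 2) ^ (r - 1) : ℝ) : ℂ) τ := fun r τ hτ =>
    ((hquad τ).rpow_const (Or.inl hτ.ne')).ofReal_comp
  have hev : ∀ᶠ τ : ℝ in 𝓝 0, 0 < q + 2 * τ * c + τ ^ 2 := by
    have : ContinuousAt (fun τ : ℝ => q + 2 * τ * c + τ ^ 2) 0 := (hquad 0).continuousAt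
    exact this.eventually (lt_mem_nhds (by simpa using hq))
  have hd1 : (deriv fun τ : ℝ => (ζ + τ * ω) ^ (N + 2) *
        (((q + 2 * τ * c + τ ^ 2) ^ (-κ) : ℝ) : ℂ)) =ᶠ[𝓝 0] fun τ =>
      ((N + 2) * ω) * ((ζ + τ * ω) ^ (N + 1) * (((q + 2 * τ * c + τ ^ 2) ^ (-κ) : ℝ) : ℂ)) +
      (-κ) * ((ζ + τ * ω) ^ (N + 2) *
        ((2 * c + 2 * τ) * (((q + 2 * τ * c + τ ^ 2) ^ (-κ - 1) : ℝ) : ℂ))) := by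
    filter_upwards [hev] with τ hτ
    rw [((hpow (N + 1) τ).fun_mul (hrpow (-κ) τ hτ)).deriv]
    push_cast
    ring
  rw [hd1.deriv_eq]
  have hq0 : 0 < q + 2 * (0 : ℝ) * c + (0 : ℝ) ^ 2 := by simpa using hq
  have hl : HasDerivAt (fun τ : ℝ => (2 * c + 2 * τ : ℂ)) 2 0 := by
    simpa using ((Complex.ofRealCLM.hasDerivAt (x := 0)).const_mul (2 : ℂ)).const_add (2 * c : ℂ)
  have hA := ((hpow N 0).fun_mul (hrpow (-κ) 0 hq0)).const_mul ((N + 2) * ω)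
  have hB := ((hpow (N + 1) 0).fun_mul (hl.fun_mul (hrpow (-κ - 1) 0 hq0))).const_mul (-κ : ℂ)
  refine ((hA.fun_add hB).deriv).trans ?_
  have e : -κ - 1 - 1 = -κ - 2 := by ring
  simp only [e]
  push_cast
  simp only [zero_mul, mul_zero, add_zero, ne_eq, OfNat.ofNat_ne_zero,
    not_false_eq_true, zero_pow]
  ring

variable {n : ℕ}

/-- The null vector functional `u ↦ u_{n+1} + i u_1`. -/
def nullFunctional (u : AmbientSpace n) : ℂ := u (Fin.last n) + Complex.I * u 0

/-- A Kelvin transform of a power of `nullFunctional`: harmonic away from the origin, homogeneous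
of degree `-(n + 1 + N)`, and without zeros in the upper half space. -/
def decayingKernel (n N : ℕ) (u : AmbientSpace n) : ℂ :=
  nullFunctional u ^ (N + 2) * (((‖u‖ ^ 2) ^ (-(((n : ℝ) + 3) / 2 + N)) : ℝ) : ℂ)

theorem harmonicAt_decayingKernel_sub (hn : 1 ≤ n) (N : ℕ) (b : AmbientSpace n)
    {z : AmbientSpace n} (hz : z ≠ b) : HarmonicAt (fun z => decayingKernel n N (z - b)) z := by
  have hcd : ∀ z, z ≠ b → ContDiffAt ℝ 2 (fun z => decayingKernel n N (z - b)) z := by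
    intro z hz
    have h0 : ‖z - b‖ ^ 2 ≠ 0 := by simpa [sub_eq_zero] using hz
    have h1 : ContDiffAt ℝ 2 (fun z : AmbientSpace n => ‖z - b‖ ^ 2) z :=
      (contDiffAt_id.sub contDiffAt_const).norm_sq ℝ
    have h2 : ContDiffAt ℝ 2 (fun z : AmbientSpace n => nullFunctional (z - b)) z := by
      unfold nullFunctional
      have hc : ∀ i, ContDiffAt ℝ 2 (fun z : AmbientSpace n => (((z - b) i : ℝ) : ℂ)) z := fun i => by
        have h : ContDiffAt ℝ 2 (fun z : AmbientSpace n => z i - b i) z := by fun_prop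
        exact Complex.ofRealCLM.contDiff.contDiffAt.comp z h
      exact (hc _).add (contDiffAt_const.mul (hc 0))
    exact (h2.pow _).mul (Complex.ofRealCLM.contDiff.contDiffAt.comp z
      (h1.rpow_const_of_ne h0))
  refine ⟨hcd z hz, ?_⟩
  filter_upwards [isOpen_ne.mem_nhds hz] with z hz
  rw [(hcd z hz).laplacian_eq_sum_deriv_deriv (EuclideanSpace.basisFun (Fin (n + 1)) ℝ)]
  set u := z - b
  set κ : ℝ := ((n : ℝ) + 3) / 2 + N
  set q := ‖u‖ ^ 2
  have hq : 0 < q := by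
    have : 0 < ‖u‖ := norm_pos_iff.2 (sub_ne_zero.2 hz)
    positivity
  set ω : Fin (n + 1) → ℂ := fun i => nullFunctional (EuclideanSpace.basisFun (Fin (n + 1)) ℝ i)
  have hω : ∀ i, ω i = (if i = Fin.last n then 1 else 0) + Complex.I * (if i = 0 then 1 else 0) := by
    intro i
    by_cases h1 : i = Fin.last n <;> by_cases h2 : i = 0 <;>
      simp [ω, nullFunctional, eq_comm, h1, h2, Nat.one_le_iff_ne_zero.1 hn]
  have hl0 : Fin.last n ≠ 0 := by
    intro h
    have := congrArg Fin.val h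
    simp at this
    omega
  have hline : ∀ i, (fun τ : ℝ => decayingKernel n N
        (z + τ • EuclideanSpace.basisFun (Fin (n + 1)) ℝ i - b)) =
      fun τ : ℝ => (nullFunctional u + τ * ω i) ^ (N + 2) *
        (((q + 2 * τ * u i + τ ^ 2) ^ (-κ) : ℝ) : ℂ) := by
    intro i
    funext τ
    have h1 : z + τ • EuclideanSpace.basisFun (Fin (n + 1)) ℝ i - b =
        u + τ • EuclideanSpace.basisFun (Fin (n + 1)) ℝ i := by simp only [u]; abel
    have h2 : nullFunctional (u + τ • EuclideanSpace.basisFun (Fin (n + 1)) ℝ i) =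
        nullFunctional u + τ * ω i := by
      simp only [nullFunctional, ω, PiLp.add_apply, PiLp.smul_apply, smul_eq_mul]
      push_cast
      ring
    have h3 : ‖u + τ • EuclideanSpace.basisFun (Fin (n + 1)) ℝ i‖ ^ 2 =
        q + 2 * τ * u i + τ ^ 2 := by
      rw [norm_add_sq_real, inner_smul_right, EuclideanSpace.inner_basisFun_real,
        norm_smul, OrthonormalBasis.norm_eq_one]
      simp [q]
      ring
    rw [h1, decayingKernel, h2, h3]
  -- The coefficient vector is isotropic because its two nonzero entries `1` and `i` sit at
  -- different places, which requires `1 ≤ n`.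
  have hS1 : ∑ i, ω i ^ 2 = 0 := by
    have : ∀ i, ω i ^ 2 = (if i = Fin.last n then 1 else 0) - (if i = 0 then 1 else 0) := by
      intro i
      rw [hω]
      by_cases h1 : i = Fin.last n
      · subst h1; simp [hl0]
      · rw [if_neg h1]
        by_cases h2 : i = 0 <;> simp [h2]
    simp [this]
  have hS2 : ∑ i, ω i * (u i : ℂ) = nullFunctional u := by
    simp [hω, nullFunctional, add_mul, Finset.sum_add_distrib]
  have hS3 : ∑ i, ((u i : ℝ) : ℂ) ^ 2 = (q : ℂ) := by
    have : q = ∑ i, u i ^ 2 := by simp [q, EuclideanSpace.real_norm_sq_eq]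
    rw [this]; push_cast; rfl
  -- What remains is `2 κ ζ ^ (N + 2) q ^ (-κ - 1)` times `2 (κ + 1) - 2 (N + 2) - (n + 1)`, with `ζ
  -- = nullFunctional u`; the choice `κ = (n + 3) / 2 + N` makes the last factor zero.
  simp only [hline, deriv_deriv_pow_mul_rpow _ _ N hq, Finset.sum_add_distrib,
    Finset.sum_sub_distrib, ← Finset.mul_sum, hS1, hS2, hS3]
  have hqq : (q ^ (-κ - 1) : ℝ) = q ^ (-κ - 2) * q := by
    rw [← Real.rpow_add_one hq.ne']; congr 1; ring
  have hκ : (κ : ℂ) = ((n : ℂ) + 3) / 2 + N := by simp [κ]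
  simp only [Finset.sum_const, Finset.card_univ, Fintype.card_fin, hqq, nsmul_eq_mul, hκ]
  push_cast
  simp only [Pi.zero_apply]
  ring

end HarmonicKernel

/-! ### Test functions adapted to a Whitney cube. -/

section TestFunctions

variable {n : ℕ}

theorem norm_nullFunctional_sq (u : AmbientSpace n) :
    ‖nullFunctional u‖ ^ 2 = u (Fin.last n) ^ 2 + u 0 ^ 2 := by
  rw [← Complex.normSq_eq_norm_sq, nullFunctional, mul_comm, Complex.normSq_add_mul_I]

theorem sq_add_sq_le_norm_sq (u : AmbientSpace n) {i j : Fin (n + 1)} (hij : i ≠ j) :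
    u i ^ 2 + u j ^ 2 ≤ ‖u‖ ^ 2 := by
  rw [EuclideanSpace.real_norm_sq_eq, ← Finset.sum_pair (f := fun k => u k ^ 2) hij]
  exact Finset.sum_le_sum_of_subset_of_nonneg (Finset.subset_univ _) fun _ _ _ => sq_nonneg _

theorem sq_rpow_neg_eq {r : ℝ} (hr : 0 < r) (N : ℕ) :
    (r ^ 2) ^ (-(((n : ℝ) + 3) / 2 + N)) = (r ^ (N + 2))⁻¹ * r ^ (-((n : ℝ) + 1 + N)) := by
  rw [← Real.rpow_natCast r 2, ← Real.rpow_mul hr.le, ← Real.rpow_natCast r (N + 2),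
    ← Real.rpow_neg hr.le, ← Real.rpow_add hr]
  congr 1
  push_cast
  ring

theorem norm_decayingKernel_le (hn : 1 ≤ n) (N : ℕ) {u : AmbientSpace n} (hu : 0 < ‖u‖) :
    ‖decayingKernel n N u‖ ≤ ‖u‖ ^ (-((n : ℝ) + 1 + N)) := by
  have h0 : Fin.last n ≠ 0 := by
    intro h
    have := congrArg Fin.val h
    simp at this
    omega
  have h1 : ‖nullFunctional u‖ ≤ ‖u‖ := by
    refine (sq_le_sq₀ (norm_nonneg _) (norm_nonneg _)).1 ?_
    rw [norm_nullFunctional_sq]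
    exact sq_add_sq_le_norm_sq u h0
  rw [decayingKernel, norm_mul, norm_pow, Complex.norm_real,
    Real.norm_of_nonneg (by positivity), sq_rpow_neg_eq hu]
  calc ‖nullFunctional u‖ ^ (N + 2) * ((‖u‖ ^ (N + 2))⁻¹ * ‖u‖ ^ (-((n : ℝ) + 1 + N)))
      ≤ ‖u‖ ^ (N + 2) * ((‖u‖ ^ (N + 2))⁻¹ * ‖u‖ ^ (-((n : ℝ) + 1 + N))) := by gcongr
    _ = _ := by rw [mul_inv_cancel_left₀ (by positivity)]

/-- The null functional has real part `u (Fin.last n) ≥ δ`, so it cannot be small, and the negative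
power of `‖u‖` is bounded below through `‖u‖ ≤ R * δ`. -/
theorem le_norm_decayingKernel (N : ℕ) {u : AmbientSpace n} {δ R : ℝ} (hδ : 0 < δ)
    (hu : δ ≤ u (Fin.last n)) (huR : ‖u‖ ≤ R * δ) :
    R ^ (-((n : ℝ) + 3 + 2 * N)) * δ ^ (-((n : ℝ) + 1 + N)) ≤ ‖decayingKernel n N u‖ := by
  have h1 : δ ≤ ‖nullFunctional u‖ := by
    refine (sq_le_sq₀ hδ.le (norm_nonneg _)).1 ?_
    rw [norm_nullFunctional_sq]
    nlinarith [sq_nonneg (u 0)]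
  have h2 : δ ≤ ‖u‖ := hu.trans ((le_abs_self _).trans (PiLp.norm_apply_le u (Fin.last n)))
  have hu0 : 0 < ‖u‖ := hδ.trans_le h2
  have hR : 0 < R := by
    by_contra h
    have : R * δ ≤ 0 := mul_nonpos_of_nonpos_of_nonneg (not_lt.1 h) hδ.le
    linarith
  rw [decayingKernel, norm_mul, norm_pow, Complex.norm_real, Real.norm_of_nonneg (by positivity)]
  calc R ^ (-((n : ℝ) + 3 + 2 * N)) * δ ^ (-((n : ℝ) + 1 + N))
      = δ ^ (N + 2) * ((R * δ) ^ 2) ^ (-(((n : ℝ) + 3) / 2 + N)) := by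
        rw [mul_pow, Real.mul_rpow (by positivity) (by positivity), sq_rpow_neg_eq hδ,
          ← Real.rpow_natCast R 2, ← Real.rpow_mul hR.le]
        have : ((2 : ℕ) : ℝ) * -(((n : ℝ) + 3) / 2 + N) = -((n : ℝ) + 3 + 2 * N) := by
          push_cast; ring
        rw [this]
        field_simp
    _ ≤ ‖nullFunctional u‖ ^ (N + 2) * (‖u‖ ^ 2) ^ (-(((n : ℝ) + 3) / 2 + N)) := by
        refine mul_le_mul (by gcongr) ?_ (by positivity) (by positivity)
        refine Real.rpow_le_rpow_of_nonpos (by positivity) (by gcongr) ?_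
        have : (0 : ℝ) ≤ n := n.cast_nonneg
        have : (0 : ℝ) ≤ N := N.cast_nonneg
        linarith

/-- Near zero the integrand is at most `x ^ s`, beyond one at most `x ^ (s - K)`; the two hypotheses
are the respective integrability thresholds. -/
theorem integrableOn_rpow_mul_one_add_rpow {s K : ℝ} (hs : -1 < s) (hK : s + 1 < K) :
    IntegrableOn (fun x : ℝ => x ^ s * (1 + x) ^ (-K)) (Ioi 0) := by
  have hK0 : 0 < K := by linarith
  have hmeas : Measurable fun x : ℝ => x ^ s * (1 + x) ^ (-K) := by fun_prop
  rw [← Ioc_union_Ioi_eq_Ioi zero_le_one]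
  refine IntegrableOn.union ?_ ?_
  · have h1 : IntegrableOn (fun x : ℝ => x ^ s) (Ioc 0 1) :=
      (intervalIntegrable_iff_integrableOn_Ioc_of_le zero_le_one).1
        (intervalIntegral.intervalIntegrable_rpow' hs)
    refine h1.mono' hmeas.aestronglyMeasurable ?_
    filter_upwards [ae_restrict_mem measurableSet_Ioc] with x hx
    have hx0 : 0 < x := hx.1
    rw [Real.norm_of_nonneg (by positivity)]
    exact mul_le_of_le_one_right (by positivity)
      (Real.rpow_le_one_of_one_le_of_nonpos (by linarith) (by linarith))
  · have h1 : IntegrableOn (fun x : ℝ => x ^ (s - K)) (Ioi 1) :=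
      integrableOn_Ioi_rpow_of_lt (by linarith) one_pos
    refine h1.mono' hmeas.aestronglyMeasurable ?_
    filter_upwards [ae_restrict_mem measurableSet_Ioi] with x hx
    have hx0 : 0 < x := one_pos.trans hx
    rw [Real.norm_of_nonneg (by positivity), sub_eq_add_neg, Real.rpow_add hx0]
    gcongr ?_ * ?_
    exact Real.rpow_le_rpow_of_nonpos hx0 (by linarith) (by linarith)

theorem lintegral_comp_inv_mul_sub {h : ℝ → ENNReal} (hh : Measurable h) {δ : ℝ} (hδ : 0 < δ)
    (b : ℝ) : ∫⁻ x, h (δ⁻¹ * (x - b)) = ENNReal.ofReal δ * ∫⁻ x, h x := by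
  rw [lintegral_sub_right_eq_self (fun x => h (δ⁻¹ * x)) b]
  conv_rhs => rw [← Real.smul_map_volume_mul_left (inv_pos.2 hδ).ne']
  rw [lintegral_smul_measure, lintegral_map hh (measurable_const_mul _), abs_of_pos (inv_pos.2 hδ),
    smul_eq_mul, ← mul_assoc, ← ENNReal.ofReal_mul hδ.le, mul_inv_cancel₀ hδ.ne']
  simp

theorem lintegral_prod_eval {h : Fin (n + 1) → ℝ → ENNReal} (hh : ∀ i, Measurable (h i)) :
    ∫⁻ z : AmbientSpace n, ∏ i, h i (z i) = ∏ i, ∫⁻ x, h i x := by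
  have hmeas : Measurable fun y : Fin (n + 1) → ℝ => ∏ i, h i (y i) :=
    Finset.measurable_fun_prod _ fun i _ => (hh i).comp (measurable_pi_apply i)
  rw [← lintegral_fin_prod_eq_prod (fun _ => volume) h fun i => (hh i).aemeasurable, ← volume_pi,
    ← (PiLp.volume_preserving_ofLp (Fin (n + 1))).lintegral_comp hmeas]

/-- Integrability of the product majorant of the test functions, with its scaling. -/
theorem exists_lintegral_majorant_le (n : ℕ) {s K : ℝ} (hs : -1 < s) (hK : s + 1 < K) :
    ∃ A : NNReal, ∀ (a : AmbientSpace n) (δ : ℝ), 0 < δ →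
      ∫⁻ z in upperHalfSpace n, ENNReal.ofReal (z (Fin.last n) ^ s *
        ((∏ i : Fin n, (1 + (δ⁻¹ * (z i.castSucc - a i.castSucc)) ^ 2)⁻¹) *
          (1 + δ⁻¹ * z (Fin.last n)) ^ (-K))) ≤ A * ENNReal.ofReal (δ ^ ((n : ℝ) + 1 + s)) := by
  set H : ℝ → ENNReal := fun x => ENNReal.ofReal (1 + x ^ 2)⁻¹
  set G : ℝ → ENNReal := (Ioi 0).indicator fun x => ENNReal.ofReal (x ^ s * (1 + x) ^ (-K))
  have hH : Measurable H := by fun_prop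
  have hG : Measurable G := Measurable.indicator (by fun_prop) measurableSet_Ioi
  have hIH : ∫⁻ x, H x ≠ ⊤ := integrable_inv_one_add_sq.lintegral_lt_top.ne
  have hIG : ∫⁻ x, G x ≠ ⊤ := by
    rw [lintegral_indicator measurableSet_Ioi]
    exact (integrableOn_rpow_mul_one_add_rpow hs hK).lintegral_lt_top.ne
  refine ⟨((∫⁻ x, H x) ^ n * ∫⁻ x, G x).toNNReal, fun a δ hδ => ?_⟩
  rw [ENNReal.coe_toNNReal (ENNReal.mul_ne_top (ENNReal.pow_ne_top hIH) hIG)]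
  -- The majorant splits into one-variable factors. Rescaling each gives one power of `δ`, and the
  -- weight contributes the remaining `δ ^ s`.
  set h : Fin (n + 1) → ℝ → ENNReal := Fin.snoc (α := fun _ => ℝ → ENNReal)
    (fun i : Fin n => fun x => H (δ⁻¹ * (x - a i.castSucc))) (fun x => G (δ⁻¹ * (x - 0)))
  have hh : ∀ i, Measurable (h i) := by
    intro i
    refine Fin.lastCases ?_ (fun i => ?_) i
    · simp only [h, Fin.snoc_last]; fun_prop
    · simp only [h, Fin.snoc_castSucc]; fun_prop
  have hint : ∫⁻ z : AmbientSpace n, ∏ i, h i (z i) =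
      ENNReal.ofReal δ ^ (n + 1) * ((∫⁻ x, H x) ^ n * ∫⁻ x, G x) := by
    rw [lintegral_prod_eval hh, Fin.prod_univ_castSucc]
    simp only [h, Fin.snoc_castSucc, Fin.snoc_last]
    simp only [lintegral_comp_inv_mul_sub hH hδ, lintegral_comp_inv_mul_sub hG hδ]
    rw [Finset.prod_const, Finset.card_univ, Fintype.card_fin]
    ring
  calc ∫⁻ z in upperHalfSpace n, ENNReal.ofReal (z (Fin.last n) ^ s *
        ((∏ i : Fin n, (1 + (δ⁻¹ * (z i.castSucc - a i.castSucc)) ^ 2)⁻¹) *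
          (1 + δ⁻¹ * z (Fin.last n)) ^ (-K)))
      ≤ ∫⁻ z in upperHalfSpace n, ENNReal.ofReal (δ ^ s) * ∏ i, h i (z i) := by
        refine setLIntegral_mono' isOpen_upperHalfSpace.measurableSet fun z hz => ?_
        have ht : 0 < z (Fin.last n) := hz
        have ht' : 0 < δ⁻¹ * z (Fin.last n) := by positivity
        rw [Fin.prod_univ_castSucc]
        simp only [h, Fin.snoc_castSucc, Fin.snoc_last, sub_zero, G, H]
        rw [indicator_of_mem (show δ⁻¹ * z (Fin.last n) ∈ Ioi 0 from ht'),
          ← ENNReal.ofReal_prod_of_nonneg fun i _ => by positivity, ← ENNReal.ofReal_mul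
            (Finset.prod_nonneg fun i _ => by positivity), ← ENNReal.ofReal_mul (by positivity)]
        refine ENNReal.ofReal_le_ofReal (le_of_eq ?_)
        have e : z (Fin.last n) ^ s = δ ^ s * (δ⁻¹ * z (Fin.last n)) ^ s := by
          rw [← Real.mul_rpow hδ.le ht'.le, mul_inv_cancel_left₀ hδ.ne']
        rw [e]
        ring
    _ ≤ ∫⁻ z : AmbientSpace n, ENNReal.ofReal (δ ^ s) * ∏ i, h i (z i) :=
        setLIntegral_le_lintegral _ _
    _ = _ := by
        rw [lintegral_const_mul' _ _ ENNReal.ofReal_ne_top, hint,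
          Real.rpow_add hδ, ENNReal.ofReal_mul (by positivity), ← ENNReal.ofReal_pow hδ.le]
        have : δ ^ ((n : ℝ) + 1) = δ ^ (n + 1) := by
          rw [← Real.rpow_natCast]; push_cast; rfl
        rw [this]
        ring

/-- Of the `q` powers of decay, two are spent on each of the `n` horizontal coordinates and the
remaining `q - 2 n` on the height. This replaces a radial bound by a product. -/
theorem rpow_neg_le_majorant {ρ q t : ℝ} {v : Fin n → ℝ} (hv : ∀ i, 1 + v i ^ 2 ≤ ρ ^ 2)
    (ht : 0 < t) (hρ : 1 + t ≤ ρ) (hq : 2 * (n : ℝ) ≤ q) :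
    ρ ^ (-q) ≤ (∏ i, (1 + v i ^ 2)⁻¹) * (1 + t) ^ (-(q - 2 * n)) := by
  have hρ0 : 0 < ρ := by linarith
  have e : ρ ^ (-q) = ((ρ ^ 2)⁻¹) ^ n * ρ ^ (-(q - 2 * n)) := by
    rw [inv_pow, ← pow_mul, ← Real.rpow_natCast, ← Real.rpow_neg hρ0.le, ← Real.rpow_add hρ0]
    congr 1
    push_cast
    ring
  rw [e]
  refine mul_le_mul ?_ ?_ (by positivity) (Finset.prod_nonneg fun i _ => by positivity)
  · calc ((ρ ^ 2)⁻¹) ^ n = ∏ _i : Fin n, (ρ ^ 2)⁻¹ := by simp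
      _ ≤ _ := by
        refine Finset.prod_le_prod (fun i _ => by positivity) fun i _ => ?_
        have := hv i
        gcongr
  · exact Real.rpow_le_rpow_of_nonpos (by linarith) hρ (by linarith)

/-- Functions in the Bergman space which are at least one on a given Whitney cube, with the
expected norm. -/
theorem exists_bergman_testFunction (hn : 1 ≤ n) {p s C : ℝ} (hp : 0 < p) (hs : -1 < s)
    (hC : 0 < C) :
    ∃ A : NNReal, ∀ (a : AmbientSpace n) (l : ℝ), 0 < a (Fin.last n) → 0 ≤ l →
      l ≤ C * a (Fin.last n) → ∃ f ∈ bergmanSpace n p s,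
        eLpNorm f (ENNReal.ofReal p) (weightedMeasure n s) ^ p ≤
          A * ENNReal.ofReal (a (Fin.last n) ^ ((n : ℝ) + 1 + s)) ∧
        ∀ z ∈ axisCube a l, 1 ≤ ‖f z‖ₑ ^ p := by
  -- `N` is so large that the decay `q = (n + 1 + N) * p` leaves `q - 2 n > s + 1` for the vertical
  -- integral, however small `p` is.
  obtain ⟨N, hN⟩ := exists_nat_ge ((2 * n + |s| + 2) / p)
  rw [div_le_iff₀ hp] at hN
  have hn0 : (0 : ℝ) ≤ n := n.cast_nonneg
  set D : ℝ := n + 1 + N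
  set q : ℝ := D * p
  have hq : 2 * n + |s| + 2 ≤ q := by
    have : (N : ℝ) * p ≤ q := by
      simp only [q, D]; nlinarith
    linarith
  have hs1 := le_abs_self s
  have hs2 := abs_nonneg s
  obtain ⟨A, hA⟩ := exists_lintegral_majorant_le n hs (K := q - 2 * n) (by linarith)
  -- On the cube, the distance to the pole `b` is at most the diameter bound `√(n + 1) * C * δ` plus
  -- the shift `2 * δ`. The factor `B` then normalizes the lower bound for `‖f‖` to one.
  set R : ℝ := √(n + 1) * C + 2
  have hR : 0 < R := by positivity
  set B : ℝ := R ^ ((n : ℝ) + 3 + 2 * N)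
  have hB : 0 < B := by positivity
  refine ⟨(B ^ p).toNNReal * A, fun a l ha hl hlC => ?_⟩
  set δ := a (Fin.last n)
  -- The pole is the reflection of the lowest corner in the boundary, so `z - b` has height at least
  -- `δ` for all `z` in the half space.
  set b : AmbientSpace n := a - EuclideanSpace.single (Fin.last n) (2 * δ)
  have hb_last : b (Fin.last n) = -δ := by simp [b, δ]; ring
  have hb_cast : ∀ i : Fin n, b i.castSucc = a i.castSucc := fun i => by
    simp [b, (Fin.castSucc_lt_last i).ne]
  set f : AmbientSpace n → ℂ := (B * δ ^ D) • fun z => decayingKernel n N (z - b)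
  have hupper : ∀ z ∈ upperHalfSpace n, z ≠ b := by
    rintro z hz rfl
    rw [mem_upperHalfSpace, hb_last] at hz
    linarith
  have hharm : HarmonicOnNhd f (upperHalfSpace n) := fun z hz =>
    (harmonicAt_decayingKernel_sub hn N b (hupper z hz)).const_smul
  have hbound : ∀ z ∈ upperHalfSpace n, ‖f z‖ ^ p ≤ B ^ p *
      ((∏ i : Fin n, (1 + (δ⁻¹ * (z i.castSucc - a i.castSucc)) ^ 2)⁻¹) *
          (1 + δ⁻¹ * z (Fin.last n)) ^ (-(q - 2 * n))) := by
    intro z hz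
    have ht : 0 < z (Fin.last n) := hz
    set u := z - b
    have hu : 0 < ‖u‖ := norm_pos_iff.2 (sub_ne_zero.2 (hupper z hz))
    have hul : u (Fin.last n) = z (Fin.last n) + δ := by simp [u, hb_last]
    have huc : ∀ i : Fin n, u i.castSucc = z i.castSucc - a i.castSucc := fun i => by
      simp [u, hb_cast]
    have h1 : ‖f z‖ ≤ B * (δ⁻¹ * ‖u‖) ^ (-D) := by
      calc ‖f z‖ = B * δ ^ D * ‖decayingKernel n N u‖ := by
            simp only [f, Pi.smul_apply, norm_smul, Real.norm_of_nonneg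
              (by positivity : 0 ≤ B * δ ^ D)]
            rfl
        _ ≤ B * δ ^ D * ‖u‖ ^ (-D) := by
            gcongr; exact norm_decayingKernel_le hn N hu
        _ = _ := by
            rw [Real.mul_rpow (by positivity) hu.le, Real.inv_rpow ha.le, Real.rpow_neg ha.le,
              inv_inv, mul_assoc]
    calc ‖f z‖ ^ p ≤ (B * (δ⁻¹ * ‖u‖) ^ (-D)) ^ p := by gcongr
      _ = B ^ p * (δ⁻¹ * ‖u‖) ^ (-q) := by
          rw [Real.mul_rpow hB.le (by positivity),
            ← Real.rpow_mul (by positivity : 0 ≤ δ⁻¹ * ‖u‖), neg_mul]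
      _ ≤ _ := by
          refine mul_le_mul_of_nonneg_left ?_ (by positivity)
          refine rpow_neg_le_majorant (fun i => ?_) (by positivity) ?_ (by linarith)
          · have h2 := sq_add_sq_le_norm_sq u (Fin.castSucc_lt_last i).ne
            rw [hul, huc] at h2
            have h3 : (1 : ℝ) = δ⁻¹ ^ 2 * δ ^ 2 := by field_simp
            rw [mul_pow, mul_pow]
            calc 1 + δ⁻¹ ^ 2 * (z i.castSucc - a i.castSucc) ^ 2
                = δ⁻¹ ^ 2 * (δ ^ 2 + (z i.castSucc - a i.castSucc) ^ 2) := by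
                  rw [mul_add, ← h3]
              _ ≤ δ⁻¹ ^ 2 * ‖u‖ ^ 2 := by
                  gcongr
                  nlinarith
          · have h2 : z (Fin.last n) + δ ≤ ‖u‖ := by
              rw [← hul]
              exact (le_abs_self _).trans (PiLp.norm_apply_le u (Fin.last n))
            calc 1 + δ⁻¹ * z (Fin.last n) = δ⁻¹ * (z (Fin.last n) + δ) := by field_simp; ring
              _ ≤ δ⁻¹ * ‖u‖ := by gcongr
  have hnorm : eLpNorm f (ENNReal.ofReal p) (weightedMeasure n s) ^ p ≤
      ((B ^ p).toNNReal * A : NNReal) * ENNReal.ofReal (δ ^ ((n : ℝ) + 1 + s)) := by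
    rw [eLpNorm_ofReal_rpow hp, weightedMeasure,
      lintegral_withDensity_eq_lintegral_mul_non_measurable _ (measurable_height_rpow s)
        (Eventually.of_forall fun z => ENNReal.ofReal_lt_top)]
    calc ∫⁻ z in upperHalfSpace n,
          ((fun z : AmbientSpace n => ENNReal.ofReal (z (Fin.last n) ^ s)) *
            fun z => ‖f z‖ₑ ^ p) z
        ≤ ∫⁻ z in upperHalfSpace n, ENNReal.ofReal (B ^ p) *
            ENNReal.ofReal (z (Fin.last n) ^ s *
              ((∏ i : Fin n, (1 + (δ⁻¹ * (z i.castSucc - a i.castSucc)) ^ 2)⁻¹) *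
                (1 + δ⁻¹ * z (Fin.last n)) ^ (-(q - 2 * n)))) := by
          refine setLIntegral_mono' isOpen_upperHalfSpace.measurableSet fun z hz => ?_
          have ht : 0 < z (Fin.last n) := hz
          rw [Pi.mul_apply, ← ofReal_norm, ENNReal.ofReal_rpow_of_nonneg (norm_nonneg _) hp.le,
            ← ENNReal.ofReal_mul (by positivity), ← ENNReal.ofReal_mul (by positivity)]
          refine ENNReal.ofReal_le_ofReal ?_
          calc _ ≤ z (Fin.last n) ^ s * _ :=
                mul_le_mul_of_nonneg_left (hbound z hz) (by positivity)
            _ = _ := by ring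
      _ = ENNReal.ofReal (B ^ p) * _ := lintegral_const_mul' _ _ ENNReal.ofReal_ne_top
      _ ≤ ENNReal.ofReal (B ^ p) * (A * ENNReal.ofReal (δ ^ ((n : ℝ) + 1 + s))) :=
          mul_le_mul_right (hA a δ ha) _
      _ = _ := by rw [← mul_assoc, ENNReal.coe_mul]; rfl
  refine ⟨f, ⟨hharm, ?_, ?_⟩, hnorm, fun z hz => ?_⟩
  · exact (hharm.continuousOn.aestronglyMeasurable isOpen_upperHalfSpace.measurableSet).mono_ac
      (withDensity_absolutelyContinuous _ _)
  · rw [← ENNReal.rpow_lt_top_iff_of_pos hp]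
    exact hnorm.trans_lt (ENNReal.mul_lt_top ENNReal.coe_lt_top ENNReal.ofReal_lt_top)
  · refine ENNReal.one_le_rpow ?_ hp
    rw [← ofReal_norm, ENNReal.one_le_ofReal]
    have h1 : δ ≤ (z - b) (Fin.last n) := by
      have : δ ≤ z (Fin.last n) := (hz (Fin.last n)).1
      simp only [PiLp.sub_apply, hb_last]
      linarith
    have h2 : ‖z - b‖ ≤ R * δ := by
      have h3 := dist_le_of_mem_axisCube hl hz (corner_mem_axisCube a hl)
      have h4 : z - b = (z - a) + EuclideanSpace.single (Fin.last n) (2 * δ) := by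
        simp only [b]; abel
      calc ‖z - b‖ ≤ ‖z - a‖ + ‖EuclideanSpace.single (Fin.last n) (2 * δ)‖ := by
            rw [h4]; exact norm_add_le _ _
        _ ≤ √(n + 1) * l + 2 * δ := by
            rw [← dist_eq_norm, PiLp.norm_single, Real.norm_of_nonneg (by positivity)]
            linarith
        _ ≤ √(n + 1) * (C * δ) + 2 * δ := by gcongr
        _ = R * δ := by simp only [R]; ring
    have h5 := le_norm_decayingKernel N ha h1 h2
    simp only [f, Pi.smul_apply, norm_smul]
    rw [Real.norm_of_nonneg (by positivity)]
    calc (1 : ℝ) = B * δ ^ D * (R ^ (-((n : ℝ) + 3 + 2 * N)) * δ ^ (-D)) := by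
          rw [Real.rpow_neg hR.le, Real.rpow_neg ha.le]
          simp only [B]
          field_simp
      _ ≤ _ := by gcongr

end TestFunctions

/-! ### From the product inequality back to the Carleson condition. -/

section Main

variable {n m : ℕ}

/-- The product inequality implies the Carleson condition. -/
theorem carleson_of_product_inequality (hn : 1 ≤ n) {Q : ℕ → Set (AmbientSpace n)}
    (hQ : IsWhitneyDecomposition Q) {p : ℝ} (hp : 0 < p) {s : Fin m → ℝ} (hs : ∀ j, -1 < s j)
    {μ : Measure (AmbientSpace n)}
    (h : ∃ C : NNReal, ∀ f : Fin m → AmbientSpace n → ℂ, (∀ j, f j ∈ bergmanSpace n p (s j)) →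
      ∫⁻ z in upperHalfSpace n, ∏ j, ‖f j z‖ₑ ^ p ∂μ ≤
        C * ∏ j, (eLpNorm (f j) (ENNReal.ofReal p) (weightedMeasure n (s j))) ^ p) :
    ∃ C : NNReal, ∀ k,
      μ (Q k) / volume (Q k) ^ ((m : ℝ) + (∑ j, s j) / ((n : ℝ) + 1)) ≤ C := by
  obtain ⟨C, hC⟩ := h
  obtain ⟨c, C₂, hc, hC₂, a, l, hQa⟩ := hQ.exists_axisCube
  choose A hA using fun j => exists_bergman_testFunction hn hp (hs j) hC₂
  set E := carlesonExponent n s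
  have hE : 0 ≤ E := carlesonExponent_nonneg hs
  -- The last factor converts the height of the cube into its side, by `δ ≤ c⁻¹ * l k` and `E ≥ 0`.
  refine ⟨C * (∏ j, A j) * (c⁻¹ ^ E).toNNReal, fun k => ?_⟩
  obtain ⟨hQk, hl, ha, h1, h2⟩ := hQa k
  set δ := a k (Fin.last n)
  choose f hf hfn hf1 using fun j => hA j (a k) (l k) ha hl.le h2
  have hsub : Q k ⊆ upperHalfSpace n := by
    rw [← hQ.iUnion_eq]; exact subset_iUnion Q k
  have hle : 0 < l k ^ E := by positivity
  have hδ : δ ^ E ≤ c⁻¹ ^ E * l k ^ E := by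
    rw [← Real.mul_rpow (by positivity) hl.le]
    refine Real.rpow_le_rpow ha.le ?_ hE
    rw [inv_mul_eq_div, le_div_iff₀ hc]
    linarith
  have hmain : μ (Q k) ≤ C * ((∏ j, A j : NNReal) * ENNReal.ofReal (δ ^ E)) := by
    calc μ (Q k) = ∫⁻ _ in Q k, 1 ∂μ := (setLIntegral_one _).symm
      _ ≤ ∫⁻ z in Q k, ∏ j, ‖f j z‖ₑ ^ p ∂μ := by
          have hQm : MeasurableSet (Q k) := by
            rw [hQk]
            have : IsClosed (axisCube (a k) (l k)) := by
              simp only [axisCube, ofPred_forall, ofPred_and]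
              exact isClosed_iInter fun i => (isClosed_le (by fun_prop) (by fun_prop)).inter
                (isClosed_le (by fun_prop) (by fun_prop))
            exact this.measurableSet
          refine setLIntegral_mono' hQm fun z hz => ?_
          rw [hQk] at hz
          exact Finset.one_le_prod' fun j _ => hf1 j z hz
      _ ≤ ∫⁻ z in upperHalfSpace n, ∏ j, ‖f j z‖ₑ ^ p ∂μ := lintegral_mono_set hsub
      _ ≤ C * ∏ j, (eLpNorm (f j) (ENNReal.ofReal p) (weightedMeasure n (s j))) ^ p := hC f hf
      _ ≤ C * ∏ j, (A j * ENNReal.ofReal (δ ^ ((n : ℝ) + 1 + s j))) := by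
          gcongr with j _
          exact hfn j
      _ = _ := by
          rw [Finset.prod_mul_distrib, ENNReal.ofNNReal_finsetProd,
            ← ENNReal.ofReal_prod_of_nonneg fun j _ => by positivity,
            ← Real.rpow_sum_of_pos ha, ← carlesonExponent_eq_sum]
  rw [hQk, volume_axisCube_rpow s _ hl, ← hQk]
  refine (ENNReal.div_le_iff (by simpa using hle) ENNReal.ofReal_ne_top).2 (hmain.trans ?_)
  calc C * ((∏ j, A j : NNReal) * ENNReal.ofReal (δ ^ E))
      ≤ C * ((∏ j, A j : NNReal) * ENNReal.ofReal (c⁻¹ ^ E * l k ^ E)) := by gcongr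
    _ = _ := by
        rw [ENNReal.ofReal_mul (by positivity), ENNReal.coe_mul, ENNReal.coe_mul]
        simp only [mul_assoc]
        rfl

end Main

end

theorem theorem2 (n m : ℕ) (hn : 1 ≤ n) (hm : 1 ≤ m)
    (Q : ℕ → Set (AmbientSpace n)) (hQ : IsWhitneyDecomposition Q)
    (p : ℝ) (hp : 0 < p) (s : Fin m → ℝ) (hs : ∀ j, -1 < s j)
    (μ : MeasureTheory.Measure (AmbientSpace n)) :
    [ -- the Carleson type condition
      ∃ C : NNReal, ∀ k,
        μ (Q k) / (MeasureTheory.volume (Q k)) ^ ((m : ℝ) + (∑ j, s j) / ((n : ℝ) + 1)) ≤ C,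
      -- boundedness of the trace operator
      TraceBounded p s μ (productBergmanSpace n p s),
      -- boundedness of the trace operator on the separately harmonic functions
      TraceBounded p s μ (separateBergmanSpace n p s),
      -- the product inequality
      ∃ C : NNReal, ∀ f : Fin m → AmbientSpace n → ℂ, (∀ j, f j ∈ bergmanSpace n p (s j)) →
        ∫⁻ z in upperHalfSpace n, ∏ j, ‖f j z‖ₑ ^ p ∂μ ≤
          C * ∏ j, (MeasureTheory.eLpNorm (f j) (ENNReal.ofReal p)
            (weightedMeasure n (s j))) ^ p ].TFAE := by
  tfae_have 1 → 2 := fun ⟨_, h⟩ => traceBounded_of_carleson hm hQ hp hs h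
  tfae_have 2 → 3 := fun ⟨C, h⟩ => ⟨C, fun f hf => h f hf.1⟩
  tfae_have 3 → 4 := exists_product_inequality_of_traceBounded hp
  tfae_have 4 → 1 := carleson_of_product_inequality hn hQ hp hs
  tfae_finish
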